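/- Let $k=\mathbb F_q$ be a finite field, $\bar k$ an algebraic closure, $E/k$ an elliptic curve, $B=\mathbb Q\otimes\mathrm{End}_k(E)$ its algebra of endomorphisms defined over $k$, and $\tau\in B$ the $q$-power Frobenius endomorphism. Suppose that $E$ is of spinorial type (i.e. $B$ admits a non-trivial involution of the first kind) and let $\sigma$ be a spin structure on $E$, that is, an involution of the first kind and of orthogonal type on the central simple $\mathbb Q$-algebra $B$. Let $K=C^+(B,\sigma)$ be the even Clifford algebra of $(B,\sigma)$, let $\mathrm{GO}^+(B,\sigma)\subset B^\times$ be the group of proper similitudes, and let $\mathrm{GSpin}(B,\sigma)=K^\times$; the canonical map $B\to K$ identifies $\mathrm{GO}^+(B,\sigma)$ with $K^\times$, and $\mathrm{GSpin}(B,\sigma)\to \mathrm{GO}^+(B,\sigma)$ is then $x\mapsto x^2$. Let $W(\bar k/k)\cong\mathbb Z$ be the Weil group, generated by the geometric Frobenius $\mathrm{Frob}$, and let $\rho_{E,\sigma}:W(\bar k/k)\to\mathrm{GO}^+(B,\sigma)$ be the similitude representation $\mathrm{Frob}\mapsto\tau$. Suppose that $(B,\sigma)$ is arithmetic, i.e.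 that $\rho_{E,\sigma}$ lifts to a representation $\rho^{spin}:W(\bar k/k)\to\mathrm{GSpin}(B,\sigma)$, and that $K=\mathbb Q(\sqrt\tau)$, where $\sqrt\tau=\rho^{spin}(\mathrm{Frob})$. Put $$L(\rho^{spin},s)=\det\bigl(1-q^{-s}\rho^{spin}(\mathrm{Frob})\mid K\bigr)^{-1},$$ where $K^\times$ acts on the $\mathbb Q$-vector space $K$ by multiplication, and $$L(E,s)=\det\bigl(1-q^{-s}\,\mathrm{Frob}\mid H^1(E,\mathbb Q_\ell)\bigr)^{-1},$$ where $\ell$ is any prime different from the characteristic of $k$, $H^1(E,\mathbb Q_\ell)$ is the dual of the rational Tate module of $E$, and $\mathbb Q_\ell$ is embedded in $\mathbb C$ by any field homomorphism $\iota$. Then for all $s\in\mathbb C$ $$L(E,s)=L\bigl(\rho^{spin},\tfrac s2\bigr)^2$$ (an equality of reciprocals of entire functions, so that both sides have the same poles). In particular $L(E,1)=L\bigl(\rho^{spin},\tfrac12\bigr)^2$. -/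

import Mathlib

noncomputable section

namespace ArithSpin

open Polynomial Filter
open scoped Polynomial.Bivariate

universe u

/-- Equality in an algebraic closure is decided classically (needed for the group law). -/
instance instDecidableEqClosure (k : Type u) [Field k] : DecidableEq (AlgebraicClosure k) :=
  Classical.decEq _

section Points

variable {k : Type u} [Field k]

/-- The group `E(k̄)` of geometric points of the curve. -/
abbrev GeomPoint (W : WeierstrassCurve k) : Type u :=
  (WeierstrassCurve.Affine.baseChange W.toAffine (AlgebraicClosure k)).Point

variable (W : WeierstrassCurve k)

/-- The affine `x`-coordinate of a geometric point (with value `0` at the point at infinity). -/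
def xCoord : GeomPoint W → AlgebraicClosure k
  | .zero => 0
  | .some x _ _ => x

/-- The affine `y`-coordinate of a geometric point (with value `0` at the point at infinity). -/
def yCoord : GeomPoint W → AlgebraicClosure k
  | .zero => 0
  | .some _ y _ => y

/-- The value at a geometric point of a polynomial in the two affine coordinates
with coefficients in `k`. -/
def polyValue (a : k[X][Y]) (P : GeomPoint W) : AlgebraicClosure k :=
  aevalAeval (xCoord W P) (yCoord W P) a

/-- A function on geometric points is rational over `k` if, off a finite set of points, it is a
quotient of two polynomials in the affine coordinates with coefficients in `k`. -/
def IsRationalFun (g : GeomPoint W → AlgebraicClosure k) : Prop :=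
  ∃ a d : k[X][Y], ∀ᶠ P in cofinite, polyValue W d P ≠ 0 ∧ g P = polyValue W a P / polyValue W d P

/-- An endomorphism of the elliptic curve defined over `k`: a group endomorphism of `E(k̄)` which is
zero, or is given, off a finite set of points, by rational functions in the affine coordinates with
coefficients in `k`. -/
def IsAlgebraicEnd (φ : AddMonoid.End (GeomPoint W)) : Prop :=
  φ = 0 ∨ ((∀ᶠ P in cofinite, φ P ≠ 0) ∧
    IsRationalFun W (fun P => xCoord W (φ P)) ∧ IsRationalFun W (fun P => yCoord W (φ P)))

variable {W}

lemma eventually_ne_zero : ∀ᶠ P : GeomPoint W in cofinite, P ≠ 0 := by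
  rw [eventually_cofinite]; simp

lemma equation_coord {P : GeomPoint W} (h : P ≠ 0) :
    (WeierstrassCurve.Affine.baseChange W.toAffine (AlgebraicClosure k)).Equation
      (xCoord W P) (yCoord W P) := by
  rcases P with _ | ⟨x, y, h'⟩
  · exact absurd rfl h
  · exact h'.1

lemma polyValue_curve {P : GeomPoint W} (h : P ≠ 0) : polyValue W W.toAffine.polynomial P = 0 := by
  have h1 := equation_coord h
  rw [WeierstrassCurve.Affine.equation_iff] at h1
  simp only [polyValue, WeierstrassCurve.Affine.polynomial]
  simp
  simp at h1
  linear_combination h1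

lemma polyValue_eq_of_mk_eq {a b : k[X][Y]} (hab : WeierstrassCurve.Affine.CoordinateRing.mk W.toAffine a =
    WeierstrassCurve.Affine.CoordinateRing.mk W.toAffine b) {P : GeomPoint W} (h : P ≠ 0) :
    polyValue W a P = polyValue W b P := by
  obtain ⟨c, hc⟩ := AdjoinRoot.mk_eq_mk.1 hab
  have h2 := polyValue_curve h
  unfold polyValue at *
  rw [← sub_eq_zero, ← map_sub, hc, map_mul, h2, zero_mul]

lemma finite_xCoord_fiber (x : AlgebraicClosure k) : {P : GeomPoint W | P ≠ 0 ∧ xCoord W P = x}.Finite := by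
  by_cases hx : ∃ P : GeomPoint W, P ≠ 0 ∧ xCoord W P = x
  · obtain ⟨P, hP, rfl⟩ := hx
    refine (Set.toFinite ({P, -P} : Set (GeomPoint W))).subset ?_
    rintro Q ⟨hQ, hQx⟩
    rcases P with _ | ⟨x, y, h⟩
    · exact absurd rfl hP
    rcases Q with _ | ⟨x', y', h'⟩
    · exact absurd rfl hQ
    exact WeierstrassCurve.Affine.Point.X_eq_iff.1 hQx
  · convert Set.finite_empty (α := GeomPoint W)
    ext P
    simpa using fun h1 h2 => hx ⟨P, h1, h2⟩

lemma polyValue_dichotomy (a : k[X][Y]) :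
    (∀ᶠ P in cofinite, polyValue W a P ≠ 0) ∨ (∀ᶠ P in cofinite, polyValue W a P = 0) := by
  by_cases ha : WeierstrassCurve.Affine.CoordinateRing.mk W.toAffine a = 0
  · right
    filter_upwards [eventually_ne_zero] with P hP
    have := polyValue_eq_of_mk_eq (b := 0) (by rw [ha, map_zero]) hP
    simpa [polyValue] using this
  · left
    obtain ⟨p, q, hpq⟩ := WeierstrassCurve.Affine.CoordinateRing.exists_smul_basis_eq
      (WeierstrassCurve.Affine.CoordinateRing.mk W.toAffine a)
    have : Module.Finite k[X] W.toAffine.CoordinateRing :=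
      Module.Finite.of_basis (WeierstrassCurve.Affine.CoordinateRing.basis W.toAffine)
    have hN : Algebra.norm k[X] (WeierstrassCurve.Affine.CoordinateRing.mk W.toAffine a) ≠ 0 :=
      Algebra.norm_ne_zero_iff.2 ha
    have hc := WeierstrassCurve.Affine.CoordinateRing.coe_norm_smul_basis (W' := W.toAffine) p q
    rw [hpq] at hc
    set N := Algebra.norm k[X] (WeierstrassCurve.Affine.CoordinateRing.mk W.toAffine a) with hNdef
    have ha' : WeierstrassCurve.Affine.CoordinateRing.mk W.toAffine a =
        WeierstrassCurve.Affine.CoordinateRing.mk W.toAffine (C p + C q * Y) := by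
      rw [← hpq, map_add, map_mul, WeierstrassCurve.Affine.CoordinateRing.smul,
        WeierstrassCurve.Affine.CoordinateRing.smul, mul_one]
    have hfin : ({x : AlgebraicClosure k | aeval x N = 0}).Finite := by
      have : {x : AlgebraicClosure k | aeval x N = 0} ⊆ (N.rootSet (AlgebraicClosure k)) := by
        intro x hx
        exact (mem_rootSet.2 ⟨hN, hx⟩)
      exact (N.rootSet_finite _).subset this
    rw [eventually_cofinite]
    refine ((Set.finite_singleton (0 : GeomPoint W)).union
      (hfin.biUnion (fun x _ => finite_xCoord_fiber (W := W) x))).subset ?_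
    intro P hP
    simp only [ne_eq, not_not, Set.mem_ofPred_eq] at hP
    by_cases h0 : P = 0
    · left; exact h0
    right
    simp only [Set.mem_iUnion]
    refine ⟨xCoord W P, ?_, h0, rfl⟩
    have e1 : polyValue W (C N) P = _ := polyValue_eq_of_mk_eq hc h0
    rw [polyValue_eq_of_mk_eq ha' h0] at hP
    unfold polyValue at e1 hP
    rw [map_mul, hP, zero_mul, aevalAeval_C] at e1
    exact e1


namespace IsRationalFun

lemma congr {f g : GeomPoint W → AlgebraicClosure k} (hf : IsRationalFun W f)
    (h : ∀ᶠ P in cofinite, f P = g P) : IsRationalFun W g := by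
  obtain ⟨a, d, had⟩ := hf
  refine ⟨a, d, ?_⟩
  filter_upwards [had, h] with P h1 h2
  exact ⟨h1.1, h2 ▸ h1.2⟩

lemma poly (a : k[X][Y]) : IsRationalFun W (polyValue W a) :=
  ⟨a, 1, Eventually.of_forall fun P => by simp [polyValue]⟩

lemma const (c : k) : IsRationalFun W (fun _ => algebraMap k (AlgebraicClosure k) c) :=
  (poly (C (C c))).congr (Eventually.of_forall fun P => by simp [polyValue])

lemma x : IsRationalFun W (xCoord W) :=
  (poly (C X)).congr (Eventually.of_forall fun P => by simp [polyValue])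

lemma y : IsRationalFun W (yCoord W) :=
  (poly Y).congr (Eventually.of_forall fun P => by simp [polyValue])

lemma add {f g : GeomPoint W → AlgebraicClosure k} (hf : IsRationalFun W f)
    (hg : IsRationalFun W g) : IsRationalFun W (fun P => f P + g P) := by
  obtain ⟨a, d, had⟩ := hf
  obtain ⟨a', d', had'⟩ := hg
  refine ⟨a * d' + d * a', d * d', ?_⟩
  filter_upwards [had, had'] with P h1 h2
  rw [h1.2, h2.2]
  have h1' := h1.1
  have h2' := h2.1
  simp only [polyValue, map_mul, map_add] at *
  exact ⟨mul_ne_zero h1' h2', div_add_div _ _ h1' h2'⟩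

lemma mul {f g : GeomPoint W → AlgebraicClosure k} (hf : IsRationalFun W f)
    (hg : IsRationalFun W g) : IsRationalFun W (fun P => f P * g P) := by
  obtain ⟨a, d, had⟩ := hf
  obtain ⟨a', d', had'⟩ := hg
  refine ⟨a * a', d * d', ?_⟩
  filter_upwards [had, had'] with P h1 h2
  rw [h1.2, h2.2]
  have h1' := h1.1
  have h2' := h2.1
  simp only [polyValue, map_mul] at *
  exact ⟨mul_ne_zero h1' h2', div_mul_div_comm _ _ _ _⟩

lemma neg {f : GeomPoint W → AlgebraicClosure k} (hf : IsRationalFun W f) :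
    IsRationalFun W (fun P => - f P) :=
  ((const (-1)).mul hf).congr (Eventually.of_forall fun P => by simp)

lemma sub {f g : GeomPoint W → AlgebraicClosure k} (hf : IsRationalFun W f)
    (hg : IsRationalFun W g) : IsRationalFun W (fun P => f P - g P) :=
  (hf.add hg.neg).congr (Eventually.of_forall fun _ => (sub_eq_add_neg _ _).symm)

lemma pow {f : GeomPoint W → AlgebraicClosure k} (hf : IsRationalFun W f) (n : ℕ) :
    IsRationalFun W (fun P => f P ^ n) := by
  induction n with
  | zero => exact (const 1).congr (Eventually.of_forall fun P => by simp)
  | succ n ih => exact (ih.mul hf).congr (Eventually.of_forall fun P => (pow_succ _ _).symm)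

lemma dichotomy {f : GeomPoint W → AlgebraicClosure k} (hf : IsRationalFun W f) :
    (∀ᶠ P in cofinite, f P ≠ 0) ∨ (∀ᶠ P in cofinite, f P = 0) := by
  obtain ⟨a, d, had⟩ := hf
  rcases polyValue_dichotomy (W := W) a with h | h
  · left
    filter_upwards [had, h] with P h1 h2
    rw [h1.2]
    exact div_ne_zero h2 h1.1
  · right
    filter_upwards [had, h] with P h1 h2
    rw [h1.2, h2, zero_div]

lemma inv {f : GeomPoint W → AlgebraicClosure k} (hf : IsRationalFun W f) :
    IsRationalFun W (fun P => (f P)⁻¹) := by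
  rcases hf.dichotomy with h | h
  · obtain ⟨a, d, had⟩ := hf
    refine ⟨d, a, ?_⟩
    filter_upwards [had, h] with P h1 h2
    rw [h1.2] at h2
    refine ⟨fun h => h2 (by rw [h, zero_div]), ?_⟩
    rw [h1.2, inv_div]
  · refine (const 0).congr ?_
    filter_upwards [h] with P hP
    simp [hP]

lemma div {f g : GeomPoint W → AlgebraicClosure k} (hf : IsRationalFun W f)
    (hg : IsRationalFun W g) : IsRationalFun W (fun P => f P / g P) :=
  (hf.mul hg.inv).congr (Eventually.of_forall fun _ => (div_eq_mul_inv _ _).symm)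

lemma aeval_poly {f : GeomPoint W → AlgebraicClosure k} (hf : IsRationalFun W f) (p : k[X]) :
    IsRationalFun W (fun P => aeval (f P) p) := by
  induction p using Polynomial.induction_on' with
  | add p q hp hq => exact (hp.add hq).congr (Eventually.of_forall fun P => by simp)
  | monomial n c =>
    exact ((const c).mul (hf.pow n)).congr (Eventually.of_forall fun P => by simp [aeval_monomial])

lemma aevalAeval_poly {f g : GeomPoint W → AlgebraicClosure k} (hf : IsRationalFun W f)
    (hg : IsRationalFun W g) (a : k[X][Y]) :
    IsRationalFun W (fun P => aevalAeval (f P) (g P) a) := by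
  induction a using Polynomial.induction_on' with
  | add p q hp hq =>
    exact (hp.add hq).congr (Eventually.of_forall fun P => (map_add _ _ _).symm)
  | monomial n c =>
    refine ((hf.aeval_poly c).mul (hg.pow n)).congr (Eventually.of_forall fun P => ?_)
    rw [← C_mul_X_pow_eq_monomial, map_mul, map_pow, aevalAeval_C, aevalAeval_Y]

end IsRationalFun

lemma exists_xCoord_eq [W.IsElliptic] (x : AlgebraicClosure k) : ∃ P : GeomPoint W, xCoord W P = x := by
  have hE : (W.map (algebraMap k (AlgebraicClosure k))).IsElliptic := inferInstance
  have hd : (Cubic.toPoly ⟨0, 1,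
      (W.map (algebraMap k (AlgebraicClosure k))).a₁ * x + (W.map (algebraMap k (AlgebraicClosure k))).a₃,
      -(x ^ 3 + (W.map (algebraMap k (AlgebraicClosure k))).a₂ * x ^ 2 +
        (W.map (algebraMap k (AlgebraicClosure k))).a₄ * x +
        (W.map (algebraMap k (AlgebraicClosure k))).a₆)⟩ : (AlgebraicClosure k)[X]).degree ≠ 0 := by
    rw [Cubic.degree_of_b_ne_zero rfl one_ne_zero]; decide
  obtain ⟨y, hy⟩ := IsAlgClosed.exists_root _ hd
  have heq : (WeierstrassCurve.Affine.baseChange W.toAffine (AlgebraicClosure k)).Equation x y := by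
    rw [WeierstrassCurve.Affine.equation_iff]
    simp only [Cubic.toPoly, IsRoot.def, eval_add, eval_mul, eval_C, eval_pow, eval_X] at hy
    simp only [WeierstrassCurve.map_a₁, WeierstrassCurve.map_a₂, WeierstrassCurve.map_a₃,
      WeierstrassCurve.map_a₄, WeierstrassCurve.map_a₆] at hy
    simp
    linear_combination hy
  exact ⟨.some x y (WeierstrassCurve.Affine.equation_iff_nonsingular_of_Δ_ne_zero
    (W := (W.map (algebraMap k (AlgebraicClosure k))).toAffine) hE.isUnit.ne_zero |>.1 heq), rfl⟩

instance [W.IsElliptic] : Infinite (GeomPoint W) :=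
  Infinite.of_surjective (xCoord W) exists_xCoord_eq

lemma end_eq_zero_of_eventually [W.IsElliptic] {θ : AddMonoid.End (GeomPoint W)}
    (h : ∀ᶠ P in cofinite, θ P = 0) : θ = 0 := by
  ext1 P
  have h' : ∀ᶠ Q in cofinite, θ (P - Q) = 0 :=
    (sub_right_injective (b := P) |>.tendsto_cofinite).eventually h
  obtain ⟨Q, h1, h2⟩ := (h.and h').exists
  rw [map_sub, h1, sub_zero] at h2
  simpa using h2

lemma tendsto_cofinite_of_eventually_ne {θ : AddMonoid.End (GeomPoint W)}
    (h : ∀ᶠ P in cofinite, θ P ≠ 0) : Tendsto θ cofinite cofinite := by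
  refine Filter.Tendsto.cofinite_of_finite_preimage_singleton fun b => ?_
  by_cases hb : ∃ P, θ P = b
  · obtain ⟨P, rfl⟩ := hb
    have h0 : {Q | θ Q = 0}.Finite := by simpa [eventually_cofinite] using h
    refine Set.Finite.to_subtype ((h0.image (fun Q => Q + P)).subset ?_)
    intro Q hQ
    refine ⟨Q - P, ?_, by simp⟩
    have : θ Q = θ P := hQ
    simp [this]
  · have : (θ ⁻¹' {b}) = ∅ := by
      ext P; simpa using fun h => hb ⟨P, h⟩
    rw [this]; infer_instance

lemma xCoord_neg (P : GeomPoint W) : xCoord W (-P) = xCoord W P := by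
  rcases P with _ | ⟨x, y, h⟩ <;> rfl

lemma yCoord_neg {P : GeomPoint W} (hP : P ≠ 0) : yCoord W (-P) =
    - yCoord W P - algebraMap k _ W.a₁ * xCoord W P - algebraMap k _ W.a₃ := by
  rcases P with _ | ⟨x, y, h⟩
  · exact absurd rfl hP
  · rfl

lemma coord_ext {P Q : GeomPoint W} (hP : P ≠ 0) (hQ : Q ≠ 0) (hx : xCoord W P = xCoord W Q)
    (hy : yCoord W P = yCoord W Q) : P = Q := by
  rcases P with _ | ⟨x, y, h⟩
  · exact absurd rfl hP
  rcases Q with _ | ⟨x', y', h'⟩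
  · exact absurd rfl hQ
  have hx' : x = x' := hx
  have hy' : y = y' := hy
  subst hx' hy'
  rfl

lemma isAlgebraicEnd_neg {φ : AddMonoid.End (GeomPoint W)} (hφ : IsAlgebraicEnd W φ) :
    IsAlgebraicEnd W (-φ) := by
  rcases hφ with rfl | ⟨h0, hx, hy⟩
  · left; simp
  · right
    refine ⟨?_, ?_, ?_⟩
    · filter_upwards [h0] with P hP
      exact neg_ne_zero.2 hP
    · exact hx.congr (Eventually.of_forall fun P => (xCoord_neg _).symm)
    · refine ((hy.neg.sub ((IsRationalFun.const W.a₁).mul hx)).sub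
        (IsRationalFun.const W.a₃)).congr ?_
      filter_upwards [h0] with P hP
      exact (yCoord_neg hP).symm

lemma isAlgebraicEnd_one : IsAlgebraicEnd W 1 :=
  Or.inr ⟨eventually_ne_zero, IsRationalFun.x, IsRationalFun.y⟩

lemma isAlgebraicEnd_mul {φ ψ : AddMonoid.End (GeomPoint W)} (hφ : IsAlgebraicEnd W φ)
    (hψ : IsAlgebraicEnd W ψ) : IsAlgebraicEnd W (φ * ψ) := by
  rcases hψ with rfl | ⟨k0, kx, ky⟩
  · left; simp
  rcases hφ with rfl | ⟨h0, hx, hy⟩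
  · left; simp
  have ht := tendsto_cofinite_of_eventually_ne k0
  have key : ∀ g : GeomPoint W → AlgebraicClosure k, IsRationalFun W g →
      IsRationalFun W (fun P => g (ψ P)) := by
    rintro g ⟨a, d, had⟩
    refine ((kx.aevalAeval_poly ky a).div (kx.aevalAeval_poly ky d)).congr ?_
    filter_upwards [ht.eventually had] with P hP
    exact hP.2.symm
  exact Or.inr ⟨ht.eventually h0, key _ hx, key _ hy⟩

lemma coord_add {P Q : GeomPoint W} (hP : P ≠ 0) (hQ : Q ≠ 0)
    (hxy : ¬(xCoord W P = xCoord W Q ∧ yCoord W P = yCoord W (-Q))) :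
    P + Q ≠ 0 ∧
    xCoord W (P + Q) = (WeierstrassCurve.Affine.baseChange W.toAffine (AlgebraicClosure k)).addX
      (xCoord W P) (xCoord W Q)
      ((WeierstrassCurve.Affine.baseChange W.toAffine (AlgebraicClosure k)).slope
        (xCoord W P) (xCoord W Q) (yCoord W P) (yCoord W Q)) ∧
    yCoord W (P + Q) = (WeierstrassCurve.Affine.baseChange W.toAffine (AlgebraicClosure k)).addY
      (xCoord W P) (xCoord W Q) (yCoord W P)
      ((WeierstrassCurve.Affine.baseChange W.toAffine (AlgebraicClosure k)).slope
        (xCoord W P) (xCoord W Q) (yCoord W P) (yCoord W Q)) := by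
  rcases P with _ | ⟨x, y, h⟩
  · exact absurd rfl hP
  rcases Q with _ | ⟨x', y', h'⟩
  · exact absurd rfl hQ
  have hxy' : ¬(x = x' ∧ y =
      (WeierstrassCurve.Affine.baseChange W.toAffine (AlgebraicClosure k)).negY x' y') := hxy
  rw [WeierstrassCurve.Affine.Point.add_some (h₁ := h) (h₂ := h') hxy']
  exact ⟨WeierstrassCurve.Affine.Point.some_ne_zero _, rfl, rfl⟩

lemma add_eq_zero_of_coord {P Q : GeomPoint W} (hP : P ≠ 0) (hQ : Q ≠ 0)
    (hx : xCoord W P = xCoord W Q) (hy : yCoord W P = yCoord W (-Q)) : P + Q = 0 := by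
  rcases P with _ | ⟨x, y, h⟩
  · exact absurd rfl hP
  rcases Q with _ | ⟨x', y', h'⟩
  · exact absurd rfl hQ
  exact WeierstrassCurve.Affine.Point.add_of_Y_eq hx hy

lemma isAlgebraicEnd_add [W.IsElliptic] {φ ψ : AddMonoid.End (GeomPoint W)}
    (hφ : IsAlgebraicEnd W φ) (hψ : IsAlgebraicEnd W ψ) : IsAlgebraicEnd W (φ + ψ) := by
  have hψn := isAlgebraicEnd_neg hψ
  rcases hψ with rfl | ⟨k0, kx, ky⟩
  · have e : φ + 0 = φ := by ext1 P; exact add_zero _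
    exact e.symm ▸ hφ
  rcases hφ with rfl | ⟨h0, hx, hy⟩
  · have e : 0 + ψ = ψ := by ext1 P; exact zero_add _
    exact e.symm ▸ Or.inr ⟨k0, kx, ky⟩
  rcases hψn with hψn | ⟨-, -, ny⟩
  · have e : φ + ψ = φ := by
      ext1 P
      have h1 : -(ψ P) = 0 := DFunLike.congr_fun hψn P
      rw [neg_eq_zero] at h1
      exact (congrArg (φ P + ·) h1).trans (add_zero _)
    exact e.symm ▸ Or.inr ⟨h0, hx, hy⟩
  have main : (∀ᶠ P in cofinite, ¬(xCoord W (φ P) = xCoord W (ψ P) ∧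
        yCoord W (φ P) = yCoord W (-(ψ P)))) →
      IsRationalFun W (fun P =>
        (WeierstrassCurve.Affine.baseChange W.toAffine (AlgebraicClosure k)).slope
        (xCoord W (φ P)) (xCoord W (ψ P)) (yCoord W (φ P)) (yCoord W (ψ P))) →
      IsAlgebraicEnd W (φ + ψ) := by
    intro hne hs
    have hX : IsRationalFun W (fun P =>
        (WeierstrassCurve.Affine.baseChange W.toAffine (AlgebraicClosure k)).addX
          (xCoord W (φ P)) (xCoord W (ψ P))
          ((WeierstrassCurve.Affine.baseChange W.toAffine (AlgebraicClosure k)).slope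
          (xCoord W (φ P)) (xCoord W (ψ P)) (yCoord W (φ P)) (yCoord W (ψ P)))) :=
      (((((hs.pow 2).add ((IsRationalFun.const W.a₁).mul hs)).sub
        (IsRationalFun.const W.a₂)).sub hx).sub kx)
    refine Or.inr ⟨?_, hX.congr ?_, ((((hs.mul (hX.sub hx)).add hy).neg.sub
        ((IsRationalFun.const W.a₁).mul hX)).sub (IsRationalFun.const W.a₃)).congr ?_⟩
    · filter_upwards [h0, k0, hne] with P p1 p2 p3
      exact (coord_add p1 p2 p3).1
    · filter_upwards [h0, k0, hne] with P p1 p2 p3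
      exact (coord_add p1 p2 p3).2.1.symm
    · filter_upwards [h0, k0, hne] with P p1 p2 p3
      exact (coord_add p1 p2 p3).2.2.symm
  rcases (hx.sub kx).dichotomy with hd | hd
  · refine main ?_ (((hy.sub ky).div (hx.sub kx)).congr ?_)
    · filter_upwards [hd] with P hP h
      exact hP (sub_eq_zero.2 h.1)
    · filter_upwards [hd] with P hP
      rw [WeierstrassCurve.Affine.slope_of_X_ne (fun h => hP (sub_eq_zero.2 h))]
  · rcases (hy.sub ny).dichotomy with hd' | hd'
    · refine main ?_ ((((((IsRationalFun.const 3).mul (hx.pow 2)).add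
        ((IsRationalFun.const (2 * W.a₂)).mul hx)).add (IsRationalFun.const W.a₄)).sub
        ((IsRationalFun.const W.a₁).mul hy)).div (hy.sub
          ((hy.neg.sub ((IsRationalFun.const W.a₁).mul hx)).sub
            (IsRationalFun.const W.a₃))) |>.congr ?_)
      · filter_upwards [hd'] with P hP h
        exact hP (sub_eq_zero.2 h.2)
      · filter_upwards [hd, hd', k0] with P h1 h2 h3
        have h2' : yCoord W (φ P) ≠
            (WeierstrassCurve.Affine.baseChange W.toAffine (AlgebraicClosure k)).negY
              (xCoord W (ψ P)) (yCoord W (ψ P)) := by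
          intro h
          apply h2
          rw [sub_eq_zero, h]
          exact (yCoord_neg h3).symm
        rw [WeierstrassCurve.Affine.slope_of_Y_ne (sub_eq_zero.1 h1) h2']
        simp [WeierstrassCurve.Affine.negY, map_ofNat]
    · left
      apply end_eq_zero_of_eventually
      filter_upwards [hd, hd', h0, k0] with P h1 h2 h3 h4
      exact add_eq_zero_of_coord h3 h4 (sub_eq_zero.1 h1) (sub_eq_zero.1 h2)

variable (W) in
/-- The ring of endomorphisms of the elliptic curve which are defined over `k`. -/
def endRing [W.IsElliptic] : Subring (AddMonoid.End (GeomPoint W)) where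
  carrier := {φ | IsAlgebraicEnd W φ}
  mul_mem' := isAlgebraicEnd_mul
  one_mem' := isAlgebraicEnd_one
  add_mem' := isAlgebraicEnd_add
  zero_mem' := Or.inl rfl
  neg_mem' := isAlgebraicEnd_neg

section Frobenius
variable (W) [Fintype k]

/-- The `q`-power Frobenius `(x, y) ↦ (x^q, y^q)` on geometric points, where `q = #k`. -/
def frobPoint : AddMonoid.End (GeomPoint W) :=
  WeierstrassCurve.Affine.Point.map (W' := W.toAffine)
    (FiniteField.frobeniusAlgHom k (AlgebraicClosure k))

variable {W}

lemma frobPoint_injective : Function.Injective (frobPoint W) :=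
  WeierstrassCurve.Affine.Point.map_injective _

lemma frobPoint_ne_zero {P : GeomPoint W} (h : P ≠ 0) : frobPoint W P ≠ 0 :=
  fun h' => h (frobPoint_injective (h'.trans (map_zero (frobPoint W)).symm))

lemma xCoord_frobPoint (P : GeomPoint W) : xCoord W (frobPoint W P) =
    FiniteField.frobeniusAlgHom k (AlgebraicClosure k) (xCoord W P) := by
  rcases P with _ | ⟨x, y, h⟩
  · exact (map_zero (FiniteField.frobeniusAlgHom k (AlgebraicClosure k))).symm
  · rfl

lemma yCoord_frobPoint (P : GeomPoint W) : yCoord W (frobPoint W P) =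
    FiniteField.frobeniusAlgHom k (AlgebraicClosure k) (yCoord W P) := by
  rcases P with _ | ⟨x, y, h⟩
  · exact (map_zero (FiniteField.frobeniusAlgHom k (AlgebraicClosure k))).symm
  · rfl

lemma isAlgebraicEnd_frobPoint : IsAlgebraicEnd W (frobPoint W) := by
  refine Or.inr ⟨?_, (IsRationalFun.x.pow (Fintype.card k)).congr ?_,
    (IsRationalFun.y.pow (Fintype.card k)).congr ?_⟩
  · filter_upwards [eventually_ne_zero] with P hP
    exact frobPoint_ne_zero hP
  · exact Eventually.of_forall fun P => (xCoord_frobPoint P).symm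
  · exact Eventually.of_forall fun P => (yCoord_frobPoint P).symm

lemma polyValue_frobPoint (a : k[X][Y]) (P : GeomPoint W) : polyValue W a (frobPoint W P) =
    FiniteField.frobeniusAlgHom k (AlgebraicClosure k) (polyValue W a P) := by
  have : aevalAeval (xCoord W (frobPoint W P)) (yCoord W (frobPoint W P)) =
      (FiniteField.frobeniusAlgHom k (AlgebraicClosure k)).comp
        (aevalAeval (xCoord W P) (yCoord W P)) := by
    apply Polynomial.algHom_ext'
    · ext
      simp [xCoord_frobPoint]
    · simp [yCoord_frobPoint]
  exact DFunLike.congr_fun this a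

lemma rational_frobPoint {g : GeomPoint W → AlgebraicClosure k} (hg : IsRationalFun W g) :
    ∀ᶠ P in cofinite, g (frobPoint W P) =
      FiniteField.frobeniusAlgHom k (AlgebraicClosure k) (g P) := by
  obtain ⟨a, d, had⟩ := hg
  filter_upwards [had, (frobPoint_injective (W := W)).tendsto_cofinite.eventually had] with P h1 h2
  rw [h1.2, h2.2, polyValue_frobPoint, polyValue_frobPoint, map_div₀]

/-- Endomorphisms defined over `k` commute with Frobenius. -/
lemma frobPoint_commute [W.IsElliptic] {φ : AddMonoid.End (GeomPoint W)}
    (hφ : IsAlgebraicEnd W φ) : frobPoint W * φ = φ * frobPoint W := by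
  rcases hφ with rfl | ⟨h0, hx, hy⟩
  · simp
  rw [← sub_eq_zero]
  apply end_eq_zero_of_eventually
  filter_upwards [h0, (frobPoint_injective (W := W)).tendsto_cofinite.eventually h0,
    rational_frobPoint hx, rational_frobPoint hy] with P h1 h2 h3 h4
  have : frobPoint W (φ P) = φ (frobPoint W P) :=
    coord_ext (frobPoint_ne_zero h1) h2 (by rw [xCoord_frobPoint, h3])
      (by rw [yCoord_frobPoint, h4])
  exact sub_eq_zero.2 this

variable (W) in
/-- The Frobenius endomorphism as an element of the endomorphism ring. -/
def frobEnd [W.IsElliptic] : endRing W := ⟨frobPoint W, isAlgebraicEnd_frobPoint⟩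

end Frobenius

end Points

/-! ### Algebras with involution over `ℚ` -/

section Involutions

open scoped TensorProduct

variable {A : Type u} [Ring A] [Algebra ℚ A]

/-- Involutions of the first kind: additive anti-automorphisms of order dividing two which are the
identity on the centre.  (An additive map between `ℚ`-vector spaces is `ℚ`-linear.) -/
structure IsInvolutionFirstKind (σ : A →ₗ[ℚ] A) : Prop where
  map_mul : ∀ x y, σ (x * y) = σ y * σ x
  involutive : ∀ x, σ (σ x) = x
  map_center : ∀ z ∈ Subring.center A, σ z = z

/-- Involutions of orthogonal type: over every splitting field `L` of `A` and for every
identification `L ⊗ A ≃ End_L(V)`, the extended involution is adjoint to a nondegenerate symmetric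
bilinear form on `V`. -/
def IsOrthogonalType (σ : A →ₗ[ℚ] A) : Prop :=
  ∀ (L : Type) [Field L] [Algebra ℚ L] (V : Type) [AddCommGroup V] [Module L V]
    [FiniteDimensional L V] (e : (L ⊗[ℚ] A) ≃ₐ[L] Module.End L V),
    ∃ b : LinearMap.BilinForm L V, b.IsSymm ∧ b.Nondegenerate ∧
      ∀ (x : L ⊗[ℚ] A) (v w : V), b v (e x w) = b (e (σ.baseChange L x) v) w

/-- A twisted quadratic space over `ℚ`: a central simple algebra `A` of finite dimension with an
involution `σ` of the first kind and of orthogonal type. -/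
structure IsTwistedQuadraticSpace (σ : A →ₗ[ℚ] A) : Prop where
  isCentral : Algebra.IsCentral ℚ A
  isSimple : IsSimpleRing A
  finite : FiniteDimensional ℚ A
  firstKind : IsInvolutionFirstKind σ
  orthogonal : IsOrthogonalType σ

variable (A) in
/-- The degree of a central simple algebra, the square root of its dimension. -/
def csaDegree : ℕ := Nat.sqrt (Module.finrank ℚ A)

/-- The reduced trace of a central simple algebra: the trace of left multiplication by `x` is
the degree times the reduced trace of `x`. -/
def reducedTrace (x : A) : ℚ := LinearMap.trace ℚ A (LinearMap.mulLeft ℚ x) / csaDegree A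

/-- `r` is the reduced norm of `a`: it is the determinant of `a` over every splitting field. -/
def HasReducedNorm (a : A) (r : ℚ) : Prop :=
  ∀ (L : Type) [Field L] [Algebra ℚ L] (V : Type) [AddCommGroup V] [Module L V]
    [FiniteDimensional L V] (e : (L ⊗[ℚ] A) ≃ₐ[L] Module.End L V),
    LinearMap.det (e (1 ⊗ₜ a)) = algebraMap ℚ L r

/-- The sandwich map: `a ⊗ b` sends `x` to `a x b`. -/
def sandwich : A ⊗[ℚ] A →ₗ[ℚ] (A →ₗ[ℚ] A) :=
  TensorProduct.lift (LinearMap.mk₂ ℚ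
    (fun a b => LinearMap.mulRight ℚ b ∘ₗ LinearMap.mulLeft ℚ a)
    (fun a a' b => by ext x; simp [add_mul])
    (fun c a b => by ext x; simp)
    (fun a b b' => by ext x; simp [mul_add])
    (fun c a b => by ext x; simp))

variable (A) in
/-- The inclusion of `A ⊗ A` into the tensor algebra of `A`, as tensors of degree two. -/
def tensorTwo : A ⊗[ℚ] A →ₗ[ℚ] TensorAlgebra ℚ A :=
  TensorProduct.lift ((LinearMap.mul ℚ (TensorAlgebra ℚ A)).compl₁₂
    (TensorAlgebra.ι ℚ) (TensorAlgebra.ι ℚ))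

/-- The relations defining the even Clifford algebra of `(A, σ)`: a symmetric element `s` is
identified with half its reduced trace, and a degree two tensor `u` whose sandwich map is invariant
under `σ` is identified with half its image under multiplication `A ⊗ A → A`. -/
inductive CliffordRel (σ : A →ₗ[ℚ] A) : TensorAlgebra ℚ A → TensorAlgebra ℚ A → Prop
  | symm (s : A) (hs : σ s = s) :
      CliffordRel σ (TensorAlgebra.ι ℚ s)
        (algebraMap ℚ (TensorAlgebra ℚ A) (reducedTrace s / 2))
  | tensor (u : A ⊗[ℚ] A) (hu : ∀ x, sandwich u (σ x) = sandwich u x) :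
      CliffordRel σ (tensorTwo A u)
        (TensorAlgebra.ι ℚ ((1 / 2 : ℚ) • LinearMap.mul' ℚ A u))

/-- The even Clifford algebra `C⁺(A, σ)` of an algebra with orthogonal involution. -/
abbrev EvenClifford (σ : A →ₗ[ℚ] A) : Type u := RingQuot (CliffordRel σ)

/-- The canonical linear map `A → C⁺(A, σ)`. -/
def toEvenClifford (σ : A →ₗ[ℚ] A) : A →ₗ[ℚ] EvenClifford σ :=
  (RingQuot.mkAlgHom ℚ (CliffordRel σ)).toLinearMap ∘ₗ TensorAlgebra.ι ℚ

/-- The group of `ℚ`-points of `GSpin(A, σ) = R_{K/ℚ} 𝔾_m`, where `K = C⁺(A, σ)`. -/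
abbrev GSpin (σ : A →ₗ[ℚ] A) : Type u := (EvenClifford σ)ˣ

lemma IsInvolutionFirstKind.map_algebraMap {σ : A →ₗ[ℚ] A} (hσ : IsInvolutionFirstKind σ) (r : ℚ) :
    σ (algebraMap ℚ A r) = algebraMap ℚ A r :=
  hσ.map_center _ (Subring.mem_center_iff.2 fun g => (Algebra.commutes r g).symm)

lemma HasReducedNorm.mul {a a' : A} {r r' : ℚ} (h : HasReducedNorm a r)
    (h' : HasReducedNorm a' r') : HasReducedNorm (a * a') (r * r') := by
  intro L _ _ V _ _ _ e
  have : (1 : L) ⊗ₜ[ℚ] (a * a') = (1 ⊗ₜ a) * (1 ⊗ₜ a') := by simp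
  rw [this, _root_.map_mul e, _root_.map_mul LinearMap.det, h L V e, h' L V e,
    _root_.map_mul (algebraMap ℚ L)]

lemma HasReducedNorm.one : HasReducedNorm (1 : A) 1 := by
  intro L _ _ V _ _ _ e
  have : (1 : L) ⊗ₜ[ℚ] (1 : A) = 1 := rfl
  rw [this, map_one e, map_one, map_one]

lemma HasReducedNorm.inv {a : Aˣ} {r : ℚ} (h : HasReducedNorm (a : A) r) :
    HasReducedNorm ((a⁻¹ : Aˣ) : A) r⁻¹ := by
  intro L _ _ V _ _ _ e
  have h1 : ((1 : L) ⊗ₜ[ℚ] ((a⁻¹ : Aˣ) : A)) * (1 ⊗ₜ[ℚ] (a : A)) = 1 := by simp; rfl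
  have h2 := congrArg (fun x => LinearMap.det (e x)) h1
  simp only [_root_.map_mul, map_one, h L V e] at h2
  rw [map_inv₀]
  exact eq_inv_of_mul_eq_one_left h2

/-- The group `GO⁺(A, σ)` of proper similitudes: units `g` with `σ(g) g = μ ∈ ℚ` and, when the
degree of `A` is `2m`, with reduced norm `μ ^ m`. -/
def GOPlus {σ : A →ₗ[ℚ] A} (hσ : IsInvolutionFirstKind σ) : Subgroup Aˣ where
  carrier := {g | ∃ μ : ℚ, σ g * g = algebraMap ℚ A μ ∧
    ∀ m : ℕ, csaDegree A = 2 * m → HasReducedNorm (g : A) (μ ^ m)}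
  mul_mem' := by
    rintro a b ⟨μ, h1, h2⟩ ⟨ν, h3, h4⟩
    refine ⟨μ * ν, ?_, fun m hm => ?_⟩
    · rw [Units.val_mul, hσ.map_mul, mul_assoc, ← mul_assoc (σ (a : A)), h1,
        Algebra.commutes μ, ← mul_assoc, h3, ← _root_.map_mul, mul_comm ν]
    · rw [mul_pow]
      exact (h2 m hm).mul (h4 m hm)
  one_mem' := by
    refine ⟨1, ?_, fun m _ => ?_⟩
    · have := hσ.map_algebraMap 1
      simpa using this
    · simpa using HasReducedNorm.one
  inv_mem' := by
    rintro a ⟨μ, h1, h2⟩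
    refine ⟨μ⁻¹, ?_, fun m hm => ?_⟩
    · have e1 : σ 1 = (1 : A) := by simpa using hσ.map_algebraMap 1
      have e2 : (a : A) * σ a = algebraMap ℚ A μ := by
        have : (a : A) * σ a * a = algebraMap ℚ A μ * a := by
          rw [mul_assoc, h1, Algebra.commutes]
        exact (Units.mul_left_inj a).1 this
      have e3 : σ ((a⁻¹ : Aˣ) : A) * ((a⁻¹ : Aˣ) : A) * algebraMap ℚ A μ = 1 := by
        rw [← e2, mul_assoc, ← mul_assoc ((a⁻¹ : Aˣ) : A), Units.inv_mul, one_mul, ← hσ.map_mul,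
          Units.mul_inv, e1]
      rcases eq_or_ne μ 0 with rfl | hμ
      · rw [map_zero, mul_zero] at e3
        have := subsingleton_of_zero_eq_one e3
        exact Subsingleton.elim _ _
      · calc σ ((a⁻¹ : Aˣ) : A) * ((a⁻¹ : Aˣ) : A)
            = σ ((a⁻¹ : Aˣ) : A) * ((a⁻¹ : Aˣ) : A) *
                (algebraMap ℚ A μ * algebraMap ℚ A μ⁻¹) := by
              rw [← _root_.map_mul, mul_inv_cancel₀ hμ, map_one, mul_one]
          _ = algebraMap ℚ A μ⁻¹ := by rw [← mul_assoc, e3, one_mul]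
    · rw [inv_pow]
      exact (h2 m hm).inv

lemma hasReducedNorm_algebraMap (r : ℚ) : HasReducedNorm (algebraMap ℚ A r) (r ^ csaDegree A) := by
  intro L _ _ V _ _ _ e
  have h1 : (1 : L) ⊗ₜ[ℚ] (algebraMap ℚ A r) = algebraMap L (L ⊗[ℚ] A) (algebraMap ℚ L r) := by
    rw [Algebra.TensorProduct.algebraMap_apply, Algebra.algebraMap_eq_smul_one,
      TensorProduct.tmul_smul, TensorProduct.smul_tmul', Algebra.algebraMap_self_apply,
      Algebra.algebraMap_eq_smul_one]
  have h2 : csaDegree A = Module.finrank L V := by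
    have h3 := e.toLinearEquiv.finrank_eq
    rw [Module.finrank_baseChange, Module.finrank_linearMap] at h3
    rw [csaDegree, h3, Nat.sqrt_eq]
  rw [h1, e.commutes, Algebra.algebraMap_eq_smul_one, LinearMap.det_smul, h2]
  simp

lemma mem_GOPlus_of_scalar {σ : A →ₗ[ℚ] A} (hσ : IsInvolutionFirstKind σ) (g : Aˣ) (r : ℚ)
    (hg : (g : A) = algebraMap ℚ A r) : g ∈ GOPlus hσ := by
  refine ⟨r ^ 2, ?_, fun m hm => ?_⟩
  · rw [hg, hσ.map_algebraMap, ← _root_.map_mul, sq]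
  · rw [hg, ← pow_mul, ← hm]
    exact hasReducedNorm_algebraMap r

end Involutions

/-! ### Spin structures on elliptic curves over finite fields -/

section Spin

open scoped TensorProduct

variable {k : Type u} [Field k] (W : WeierstrassCurve k) [W.IsElliptic]

/-- The endomorphism algebra `B = ℚ ⊗ End_k(E)`. -/
abbrev EndAlg : Type u := ℚ ⊗[ℤ] endRing W

/-- The curve is of spinorial type if its endomorphism algebra admits a nontrivial involution of the
first kind. -/
def IsSpinorialType : Prop :=
  ∃ σ : EndAlg W →ₗ[ℚ] EndAlg W, IsInvolutionFirstKind σ ∧ σ ≠ LinearMap.id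

/-- A spin structure: the curve is of spinorial type, and `(B, σ)` is a twisted quadratic space. -/
structure IsSpinStructure (σ : EndAlg W →ₗ[ℚ] EndAlg W) : Prop where
  spinorial : IsSpinorialType W
  twisted : IsTwistedQuadraticSpace σ

variable [Fintype k]

/-- The Frobenius endomorphism `τ` as an element of the endomorphism algebra. -/
def frobAlg : EndAlg W := 1 ⊗ₜ frobEnd W

variable {W}

lemma frobEnd_commute (φ : endRing W) : frobEnd W * φ = φ * frobEnd W :=
  Subtype.ext (frobPoint_commute φ.2)

lemma frobAlg_commute (b : EndAlg W) : frobAlg W * b = b * frobAlg W := by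
  induction b using TensorProduct.induction_on with
  | zero => simp
  | tmul r φ => simp [frobAlg, frobEnd_commute]
  | add x y hx hy => rw [mul_add, add_mul, hx, hy]

lemma frobAlg_mul_injective (b : EndAlg W) (h : frobAlg W * b = 0) : b = 0 := by
  have hinj : Function.Injective (LinearMap.mulLeft ℤ (frobEnd W)) := by
    intro φ ψ hφ
    apply Subtype.ext
    ext1 P
    have : frobEnd W * φ = frobEnd W * ψ := hφ
    have := DFunLike.congr_fun (congrArg Subtype.val this) P
    exact frobPoint_injective this
  have h1 := Module.Flat.lTensor_preserves_injective_linearMap (M := ℚ) _ hinj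
  apply h1
  rw [map_zero, ← h]
  clear h
  induction b using TensorProduct.induction_on with
  | zero => simp
  | tmul r φ => simp [frobAlg]
  | add x y hx hy => rw [map_add, mul_add, hx, hy]

lemma isUnit_frobAlg [FiniteDimensional ℚ (EndAlg W)] : IsUnit (frobAlg W) := by
  have : IsArtinianRing (EndAlg W) := IsArtinianRing.of_finite ℚ _
  apply IsArtinianRing.isUnit_of_mem_nonZeroDivisors
  exact ⟨frobAlg_mul_injective, fun b hb => frobAlg_mul_injective b ((frobAlg_commute b).trans hb)⟩

/-- The Frobenius endomorphism as a unit of `B`. -/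
def frobUnit {σ : EndAlg W →ₗ[ℚ] EndAlg W} (hσ : IsSpinStructure W σ) : (EndAlg W)ˣ :=
  haveI := hσ.twisted.finite
  isUnit_frobAlg.unit

/-- Frobenius is a proper similitude. -/
lemma frobUnit_mem_GOPlus {σ : EndAlg W →ₗ[ℚ] EndAlg W} (hσ : IsSpinStructure W σ) :
    frobUnit hσ ∈ GOPlus hσ.twisted.firstKind := by
  have hc := hσ.twisted.isCentral
  have h1 : frobAlg W ∈ Subalgebra.center ℚ (EndAlg W) :=
    Subalgebra.mem_center_iff.2 fun b => (frobAlg_commute b).symm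
  obtain ⟨r, hr⟩ := Algebra.mem_bot.1 (hc.out h1)
  exact mem_GOPlus_of_scalar _ _ r hr.symm

variable (k) in
/-- The geometric Frobenius: the inverse of `x ↦ x ^ q` in the absolute Galois group of `k`. -/
def geomFrob : AlgebraicClosure k ≃ₐ[k] AlgebraicClosure k :=
  (FiniteField.frobeniusAlgEquivOfAlgebraic k (AlgebraicClosure k))⁻¹

variable (k) in
/-- The Weil group of a finite field: the subgroup of the absolute Galois group generated by the
geometric Frobenius. -/
def weilGroup : Subgroup (AlgebraicClosure k ≃ₐ[k] AlgebraicClosure k) :=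
  Subgroup.zpowers (geomFrob k)

variable (k) in
/-- The geometric Frobenius as an element of the Weil group. -/
def weilFrob : weilGroup k := ⟨geomFrob k, Subgroup.mem_zpowers _⟩

lemma not_isOfFinOrder_geomFrob : ¬ IsOfFinOrder (geomFrob k) := by
  rw [geomFrob, isOfFinOrder_inv_iff, isOfFinOrder_iff_pow_eq_one]
  rintro ⟨n, hn, h⟩
  have h1 : ∀ x : AlgebraicClosure k, x ^ (Fintype.card k ^ n) = x := by
    intro x
    have h2 := DFunLike.congr_fun h x
    rw [AlgEquiv.coe_pow, FiniteField.coe_frobeniusAlgEquivOfAlgebraic_iterate] at h2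
    exact h2
  have hq : 1 < Fintype.card k ^ n := Nat.one_lt_pow hn.ne' Fintype.one_lt_card
  have hne : (X ^ (Fintype.card k ^ n) - X : (AlgebraicClosure k)[X]) ≠ 0 :=
    FiniteField.X_pow_card_sub_X_ne_zero _ hq
  refine hne (Polynomial.funext fun x => ?_)
  simp [h1 x]

instance : Infinite (weilGroup k) :=
  Set.infinite_coe_iff.2 (infinite_zpowers.2 not_isOfFinOrder_geomFrob)

lemma zpowers_weilFrob : Subgroup.zpowers (weilFrob k) = ⊤ := by
  rw [eq_top_iff]
  rintro ⟨w, n, rfl⟩ -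
  exact ⟨n, rfl⟩

/-- The canonical similitude representation `W(k̄/k) → GO⁺(B, σ)`, which sends the geometric
Frobenius to the Frobenius endomorphism `τ`. -/
def similitudeRep {σ : EndAlg W →ₗ[ℚ] EndAlg W} (hσ : IsSpinStructure W σ) :
    weilGroup k →* GOPlus hσ.twisted.firstKind :=
  (zpowersHom _ ⟨frobUnit hσ, frobUnit_mem_GOPlus hσ⟩).comp
    (intEquivOfZPowersEqTop (weilFrob k) zpowers_weilFrob).symm.toMonoidHom

lemma similitudeRep_weilFrob {σ : EndAlg W →ₗ[ℚ] EndAlg W} (hσ : IsSpinStructure W σ) :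
    ((similitudeRep hσ (weilFrob k) : (EndAlg W)ˣ) : EndAlg W) = frobAlg W := by
  have : (intEquivOfZPowersEqTop (weilFrob k) zpowers_weilFrob).symm (weilFrob k) = _ :=
    intEquivOfZPowersEqTop_symm_self _
  simp only [similitudeRep, MonoidHom.comp_apply, MulEquiv.coe_toMonoidHom, this]
  simp [frobUnit]

end Spin

/-! ### Tate modules and `L`-functions -/

section Tate

variable (M : Type u) [AddCommGroup M] (ℓ : ℕ)

/-- The `ℓ`-adic Tate module of an abelian group: the inverse limit of the `ℓ ^ n`-torsion
subgroups along multiplication by `ℓ`. -/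
def tateModule : AddSubgroup (ℕ → M) where
  carrier := {P | P 0 = 0 ∧ ∀ n, ℓ • P (n + 1) = P n}
  add_mem' := by
    rintro P Q ⟨h1, h2⟩ ⟨h3, h4⟩
    exact ⟨by simp [h1, h3], fun n => by simp [h2, h4]⟩
  zero_mem' := ⟨rfl, fun n => by simp⟩
  neg_mem' := by
    rintro P ⟨h1, h2⟩
    exact ⟨by simp [h1], fun n => by simp [h2]⟩

variable {M} {ℓ}

lemma tateModule_torsion (P : tateModule M ℓ) (n : ℕ) : (ℓ ^ n) • P.1 n = 0 := by
  induction n with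
  | zero => simpa using P.2.1
  | succ n ih => rw [pow_succ, mul_smul, P.2.2 n, ih]

lemma tateModule_nsmul_congr (P : tateModule M ℓ) (n : ℕ) {a b : ℕ}
    (h : (a : ZMod (ℓ ^ n)) = b) : a • P.1 n = b • P.1 n := by
  rw [nsmul_eq_nsmul_iff_modEq]
  exact ((ZMod.natCast_eq_natCast_iff _ _ _).1 h).of_dvd
    (addOrderOf_dvd_of_nsmul_eq_zero (tateModule_torsion P n))

variable [Fact ℓ.Prime]

/-- An `ℓ`-adic integer acts on the `n`-th component through its residue modulo `ℓ ^ n`. -/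
instance : SMul ℤ_[ℓ] (tateModule M ℓ) where
  smul a P := ⟨fun n => (PadicInt.toZModPow n a).val • P.1 n, by
    refine ⟨by simp [P.2.1], fun n => ?_⟩
    rw [smul_comm, P.2.2 n]
    apply tateModule_nsmul_congr
    rw [ZMod.natCast_zmod_val, ← PadicInt.cast_toZModPow n (n + 1) n.le_succ a, ZMod.natCast_val]⟩

lemma tateModule_smul_apply (a : ℤ_[ℓ]) (P : tateModule M ℓ) (n : ℕ) :
    (a • P).1 n = (PadicInt.toZModPow n a).val • P.1 n := rfl

instance : Module ℤ_[ℓ] (tateModule M ℓ) where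
  one_smul P := by
    refine Subtype.ext (funext fun n => ?_)
    rw [tateModule_smul_apply]
    exact (tateModule_nsmul_congr P n (b := 1) (by simp)).trans (one_smul _ _)
  mul_smul a b P := by
    refine Subtype.ext (funext fun n => ?_)
    rw [tateModule_smul_apply, tateModule_smul_apply, tateModule_smul_apply, ← mul_smul]
    exact tateModule_nsmul_congr P n (by simp)
  smul_zero a := by
    refine Subtype.ext (funext fun n => ?_)
    rw [tateModule_smul_apply]
    exact smul_zero _
  smul_add a P Q := by
    refine Subtype.ext (funext fun n => ?_)
    exact smul_add _ _ _
  add_smul a b P := by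
    refine Subtype.ext (funext fun n => ?_)
    rw [tateModule_smul_apply]
    refine (tateModule_nsmul_congr P n (b := (PadicInt.toZModPow n a).val +
      (PadicInt.toZModPow n b).val) (by simp)).trans (add_smul _ _ _)
  zero_smul P := by
    refine Subtype.ext (funext fun n => ?_)
    rw [tateModule_smul_apply]
    exact (tateModule_nsmul_congr P n (b := 0) (by simp)).trans (zero_smul _ _)

variable (ℓ) in
/-- The map induced on Tate modules by a group endomorphism. -/
def tateMap (f : AddMonoid.End M) : tateModule M ℓ →ₗ[ℤ_[ℓ]] tateModule M ℓ where
  toFun P := ⟨fun n => f (P.1 n), by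
    refine ⟨by simp [P.2.1], fun n => by rw [← map_nsmul, P.2.2 n]⟩⟩
  map_add' P Q := Subtype.ext (funext fun n => map_add f _ _)
  map_smul' a P := Subtype.ext (funext fun n => map_nsmul f _ _)

end Tate

section LFunctions

open scoped TensorProduct

/-- The reversed characteristic polynomial `det (1 - T f)` of an endomorphism `f` of a finite
dimensional vector space. -/
def revCharpoly {F V : Type*} [Field F] [AddCommGroup V] [Module F V] (f : V →ₗ[F] V) : F[X] :=
  LinearMap.det ((1 : Module.End F[X] (F[X] ⊗[F] V)) - (X : F[X]) • f.baseChange F[X])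

variable {k : Type u} [Field k] (W : WeierstrassCurve k)

/-- The rational Tate module `V_ℓ(E) = ℚ_ℓ ⊗ T_ℓ(E)`. -/
abbrev rationalTate (ℓ : ℕ) [Fact ℓ.Prime] : Type u := ℚ_[ℓ] ⊗[ℤ_[ℓ]] tateModule (GeomPoint W) ℓ

/-- The `ℓ`-adic cohomology `H¹(E, ℚ_ℓ)`, the dual of the rational Tate module. -/
abbrev ellAdicH1 (ℓ : ℕ) [Fact ℓ.Prime] : Type u := Module.Dual ℚ_[ℓ] (rationalTate W ℓ)

variable [Fintype k]

/-- The action of Frobenius on `H¹(E, ℚ_ℓ)`: pull-back by the Frobenius endomorphism. -/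
def frobH1 (ℓ : ℕ) [Fact ℓ.Prime] : ellAdicH1 W ℓ →ₗ[ℚ_[ℓ]] ellAdicH1 W ℓ :=
  ((tateMap ℓ (frobPoint W)).baseChange ℚ_[ℓ]).dualMap

/-- The `L`-function `L(E, s) = Z(H¹(E), q^{-s})⁻¹`, where `Z(H¹(E), T) = det (1 - T Frob)` on
`H¹(E, ℚ_ℓ)`, and `ℚ_ℓ` is embedded into `ℂ` by `ι`. -/
def LFunctionCurve (ℓ : ℕ) [Fact ℓ.Prime] (ι : ℚ_[ℓ] →+* ℂ) (s : ℂ) : ℂ :=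
  (((revCharpoly (frobH1 W ℓ)).map ι).eval ((Fintype.card k : ℂ) ^ (-s)))⁻¹

variable {W} [W.IsElliptic]

/-- A spinorial lifting of the similitude representation along `GSpin(B, σ) → GO⁺(B, σ)`.  The
canonical map `B → C⁺(B, σ) = K` restricts to an isomorphism `GO⁺(B, σ) ≃ Kˣ`, and under this
identification the map `GSpin(B, σ) = Kˣ → GO⁺(B, σ)` is `x ↦ x²`. -/
def IsSpinorialLift {σ : EndAlg W →ₗ[ℚ] EndAlg W} (hσ : IsSpinStructure W σ)
    (ρ : weilGroup k →* GSpin σ) : Prop :=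
  ∀ w : weilGroup k, ((ρ w : EvenClifford σ)) ^ 2 =
    toEvenClifford σ ((similitudeRep hσ w : (EndAlg W)ˣ) : EndAlg W)

/-- The `L`-function `L(ρ, s) = Z(ρ, q^{-s})` of a representation `ρ : W(k̄/k) → GSpin(B, σ)`, where
`Z(ρ, T) = det (1 - T ρ(Frob))⁻¹` and `GSpin(B, σ) = Kˣ` acts by multiplication on the `ℚ`-vector
space `K = C⁺(B, σ)`. -/
def LFunctionSpin {σ : EndAlg W →ₗ[ℚ] EndAlg W} (ρ : weilGroup k →* GSpin σ) (s : ℂ) : ℂ :=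
  (((revCharpoly (LinearMap.mulLeft ℚ (ρ (weilFrob k) : EvenClifford σ))).map
    (algebraMap ℚ ℂ)).eval ((Fintype.card k : ℂ) ^ (-s)))⁻¹

end LFunctions

end ArithSpin

end

/-! Both L-functions are governed by one rational number. Endomorphisms defined over `k` commute
with Frobenius, so `τ` lies in the centre of `B`, which is `ℚ` because `(B, σ)` is a twisted
quadratic space; say `τ = r`. If `V_ℓ(E)` has dimension 2, Frobenius acts on `H¹` as the scalar `r`,
and the reciprocal of `L(E, s)` is `(1 - r q^{-s})²`. On the other side the canonical map sends `r`
to `r`, so `√τ` has square `r`. If `K = ℚ(√τ)` has dimension 2, then `1, √τ` is a basis, `det(1 -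
T√τ) = 1 - r T²`, and `T = q^{-s/2}` gives `1 - r q^{-s}`. Nothing requires `K` to be a field.

Thus the work lies in two dimension counts. For the first, write `dim B = n²` and `d = dim V_ℓ(E)`.
A nontrivial involution of the first kind excludes `n = 1`. A bound on the `ℓ`-torsion gives `d ≤
2`, and existence of nonzero `ℓ`-torsion together with divisibility gives `d ≠ 0`. As `ℚ_ℓ ⊗ B` is
simple it embeds in the `d × d` matrices, so `n ≤ d` and hence `n = d = 2`
(`IsSpinStructure.finrank_eq`). The torsion facts come from `exists_isMultiplication`: on
`x`-coordinates, multiplication by `n` is a quotient of polynomials of known degrees.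

For the second, the even Clifford algebra, given by generators and relations, must be shown larger
than `ℚ` (`evenClifford_bot_ne_top`). Over `ℂ` the algebra `B` becomes the endomorphisms of a plane
with a hyperbolic basis, and each of the two diagonal matrix entries extends to a character of `K`.
These characters differ, which is impossible if `K = ℚ`. -/

noncomputable section

/-! ### The x-coordinates of P + Q and P - Q. -/

namespace WeierstrassCurve.Affine.Point

open Polynomial

variable {F : Type*} [Field F] {W : WeierstrassCurve F}

/-- The values of the three quadratic forms `addSubMap`. -/
lemma eval_addSubMap (v : Fin 3 → F) : (fun i => (W.addSubMap i).eval v) =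
    ![v 0 ^ 2 - W.b₄ * v 0 * v 2 - W.b₆ * v 1 * v 2 - W.b₈ * v 2 ^ 2,
      2 * v 1 * v 0 + W.b₂ * v 0 * v 2 + W.b₄ * v 1 * v 2 + W.b₆ * v 2 ^ 2,
      v 1 ^ 2 - 4 * v 0 * v 2] := by
  ext i
  fin_cases i <;> simp [addSubMap]

lemma vec_three_eq {α : Type*} {a b c a' b' c' : α} (ha : a = a') (hb : b = b') (hc : c = c') :
    ![a, b, c] = ![a', b', c'] := by rw [ha, hb, hc]

variable [DecidableEq F]

/-- This is the diagonal case of `addSubMap_sym2x`, with `0` standing for `P - P`. Away from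
2-torsion it is the duplication formula, scaled by the square of `2y + a₁x + a₃`. At 2-torsion this
factor vanishes and only the first coordinate survives. -/
lemma sym2x_add_self [W.IsElliptic] (P : W.toAffine.Point) :
    ∃ c : F, c ≠ 0 ∧ (fun i => (W.addSubMap i).eval (P.sym2x P)) = c • (P + P).sym2x 0 := by
  rcases P with _ | ⟨x, y, h⟩
  · refine ⟨1, one_ne_zero, ?_⟩
    rw [eval_addSubMap, ← zero_def]
    ext i
    fin_cases i <;> simp
  have hE := (equation_iff ..).1 h.1
  by_cases hy : y = W.toAffine.negY x y
  · have h0 := addSubMap_ne_zero W (sym2x_ne_zero (some x y h) (some x y h))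
    rw [add_of_Y_eq rfl hy, sym2x_zero_zero]
    rw [eval_addSubMap] at h0 ⊢
    rw [negY] at hy
    simp only [sym2x_some_some] at h0 ⊢
    -- On the curve this expression is the square of `2y + a₁x + a₃`, which is zero here. Two
    -- coordinates vanish, so `h0` forces the remaining one to be nonzero, and it serves as the
    -- constant.
    have h1 : 2 * (x + x) * (x * x) + W.b₂ * (x * x) * 1 + W.b₄ * (x + x) * 1 + W.b₆ * 1 ^ 2 = 0 := by
      simp only [b₂, b₄, b₆]
      linear_combination (2 * y + W.a₁ * x + W.a₃) * hy - 4 * hE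
    have h2 : (x + x) ^ 2 - 4 * (x * x) * 1 = 0 := by ring
    simp only [Matrix.cons_val_zero, Matrix.cons_val_one, Matrix.cons_val] at h0 ⊢
    rw [h1, h2] at h0 ⊢
    refine ⟨(x * x) ^ 2 - W.b₄ * (x * x) * 1 - W.b₆ * (x + x) * 1 - W.b₈ * 1 ^ 2,
      fun hc => h0 ?_, by simp⟩
    rw [hc]; ext i; fin_cases i <;> rfl
  · have hd : y - W.toAffine.negY x y ≠ 0 := sub_ne_zero.2 hy
    refine ⟨(y - W.toAffine.negY x y) ^ 2, pow_ne_zero 2 hd, ?_⟩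
    have hx : (y - W.toAffine.negY x y) ^ 2 * W.toAffine.addX x x (W.toAffine.slope x x y y) =
        x ^ 4 - W.b₄ * x ^ 2 - 2 * W.b₆ * x - W.b₈ := by
      rw [addX, slope_of_Y_ne rfl hy]
      field_simp
      simp only [negY, b₄, b₆, b₈]
      linear_combination -(8 * x + W.a₁ ^ 2 + 4 * W.a₂) * hE
    rw [add_self_of_Y_ne hy, eval_addSubMap, sym2x_some_some, sym2x_some_zero]
    simp only [Matrix.cons_val_zero, Matrix.cons_val_one, Matrix.cons_val, Matrix.smul_cons,
      smul_eq_mul, Matrix.smul_empty, mul_one, mul_zero]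
    refine vec_three_eq ?_ ?_ ?_
    · rw [hx]; ring
    · simp only [negY, b₂, b₄, b₆]
      linear_combination -4 * hE
    · ring

lemma sym2x_add_sub_of_X_ne {x₁ x₂ y₁ y₂ : F} (h₁ : W.toAffine.Nonsingular x₁ y₁)
    (h₂ : W.toAffine.Nonsingular x₂ y₂) (hx : x₁ ≠ x₂) :
    (fun i => (W.addSubMap i).eval ((some x₁ y₁ h₁).sym2x (some x₂ y₂ h₂))) =
      (x₁ - x₂) ^ 2 • (some x₁ y₁ h₁ + some x₂ y₂ h₂).sym2x (some x₁ y₁ h₁ - some x₂ y₂ h₂) := by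
  have hd : x₁ - x₂ ≠ 0 := sub_ne_zero.2 hx
  have E₁ := (equation_iff ..).1 h₁.1
  have E₂ := (equation_iff ..).1 h₂.1
  rw [sub_eq_add_neg (some x₁ y₁ h₁), neg_some, add_some (fun h => hx h.1), add_some (fun h => hx h.1),
    eval_addSubMap, sym2x_some_some, sym2x_some_some, addX, addX, slope_of_X_ne hx,
    slope_of_X_ne hx]
  simp only [Matrix.cons_val_zero, Matrix.cons_val_one, Matrix.cons_val, Matrix.smul_cons,
      smul_eq_mul, Matrix.smul_empty, mul_one]
  -- `N` and `M` are the numerators of the slopes for `P + Q` and `P - Q`. Subtracting the two curve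
  -- equations shows that `x₁ - x₂` divides `N * M`; this cancels two of the four factors `x₁ - x₂`
  -- in the denominator of the product of the two x-coordinates.
  obtain ⟨N, hN⟩ : ∃ N, N = y₁ - y₂ := ⟨_, rfl⟩
  obtain ⟨M, hM⟩ : ∃ M, M = y₁ - W.toAffine.negY x₂ y₂ := ⟨_, rfl⟩
  rw [← hN, ← hM]
  rw [negY] at hM
  obtain ⟨Q, hQ⟩ : ∃ Q, Q = x₁ ^ 2 + x₁ * x₂ + x₂ ^ 2 + W.a₂ * (x₁ + x₂) + W.a₄ - W.a₁ * y₁ :=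
    ⟨_, rfl⟩
  have hNM : N * M = (x₁ - x₂) * Q := by
    rw [hN, hM, hQ]
    linear_combination E₁ - E₂
  have hS : N * (N + W.a₁ * (x₁ - x₂)) + M * (M + W.a₁ * (x₁ - x₂)) =
      2 * (x₁ + x₂) * (x₁ * x₂) + W.b₂ * (x₁ * x₂) + W.b₄ * (x₁ + x₂) + W.b₆ +
        2 * (W.a₂ + x₁ + x₂) * (x₁ - x₂) ^ 2 := by
    rw [hN, hM, b₂, b₄, b₆]
    linear_combination 2 * E₁ + 2 * E₂
  have hP : Q * (Q + W.a₁ * (N + M) + W.a₁ ^ 2 * (x₁ - x₂)) -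
      (W.a₂ + x₁ + x₂) * (2 * (x₁ + x₂) * (x₁ * x₂) + W.b₂ * (x₁ * x₂) + W.b₄ * (x₁ + x₂) + W.b₆) -
      (W.a₂ + x₁ + x₂) ^ 2 * (x₁ - x₂) ^ 2 =
      (x₁ * x₂) ^ 2 - W.b₄ * (x₁ * x₂) - W.b₆ * (x₁ + x₂) - W.b₈ := by
    rw [hN, hM, hQ, b₂, b₄, b₆, b₈]
    linear_combination -W.a₁ ^ 2 * E₁
  refine vec_three_eq ?_ ?_ ?_
  · field_simp
    linear_combination -(N * M + (x₁ - x₂) * Q + W.a₁ * (x₁ - x₂) * (N + M) +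
      W.a₁ ^ 2 * (x₁ - x₂) ^ 2) * hNM + (W.a₂ + x₁ + x₂) * (x₁ - x₂) ^ 2 * hS -
      (x₁ - x₂) ^ 2 * hP
  · field_simp
    linear_combination -hS
  · ring

/-- The addition-and-subtraction map computes the `x`-coordinates of `P + Q` and `P - Q` from those
of `P` and `Q`. -/
theorem addSubMap_sym2x [W.IsElliptic] (P Q : W.toAffine.Point) :
    ∃ c : F, c ≠ 0 ∧
      (fun i => (W.addSubMap i).eval (P.sym2x Q)) = c • (P + Q).sym2x (P - Q) := by
  -- Equal x-coordinates mean `P = ±Q`, and both signs reduce to duplication because the symmetric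
  -- pair ignores signs and order.
  have hPQ : P = Q ∨ P = -Q → ∃ c : F, c ≠ 0 ∧
      (fun i => (W.addSubMap i).eval (P.sym2x Q)) = c • (P + Q).sym2x (P - Q) := by
    rintro (rfl | rfl)
    · simpa using sym2x_add_self P
    · obtain ⟨c, hc, h⟩ := sym2x_add_self Q
      refine ⟨c, hc, ?_⟩
      rw [sym2x_neg_left, h, neg_add_cancel, sym2x_comm, ← sym2x_neg_right]
      congr 2
      abel
  rcases P with _ | ⟨x₁, y₁, h₁⟩
  · rcases Q with _ | ⟨x₂, y₂, h₂⟩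
    · exact hPQ (Or.inl rfl)
    · refine ⟨1, one_ne_zero, ?_⟩
      rw [eval_addSubMap, ← zero_def, zero_add, zero_sub, sym2x_zero_some, sym2x_neg_right,
        sym2x_some_some]
      ext i
      fin_cases i <;> simp <;> ring
  · rcases Q with _ | ⟨x₂, y₂, h₂⟩
    · refine ⟨1, one_ne_zero, ?_⟩
      rw [eval_addSubMap, ← zero_def, add_zero, sub_zero, sym2x_some_zero, sym2x_some_some]
      ext i
      fin_cases i <;> simp <;> ring
    · by_cases hx : x₁ = x₂
      · exact hPQ (eq_or_eq_neg_of_xRep_eq_xRep (by simp [hx]))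
      · exact ⟨_, pow_ne_zero 2 (sub_ne_zero.2 hx), sym2x_add_sub_of_X_ne h₁ h₂ hx⟩

end WeierstrassCurve.Affine.Point

end

/-! ### Multiplication by n on x-coordinates, divisibility and torsion. -/

noncomputable section

namespace WeierstrassCurve.Affine.Point

open Polynomial

variable {F : Type*} [Field F] {W : WeierstrassCurve F}

lemma exists_nonsingular [IsAlgClosed F] [W.IsElliptic] (x : F) : ∃ y, W.toAffine.Nonsingular x y := by
  have hd : (Cubic.toPoly ⟨0, 1, W.a₁ * x + W.a₃,
      -(x ^ 3 + W.a₂ * x ^ 2 + W.a₄ * x + W.a₆)⟩ : F[X]).degree ≠ 0 := by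
    rw [Cubic.degree_of_b_ne_zero rfl one_ne_zero]; decide
  obtain ⟨y, hy⟩ := IsAlgClosed.exists_root _ hd
  refine ⟨y, (equation_iff_nonsingular_of_Δ_ne_zero W.isUnit_Δ.ne_zero).1 ?_⟩
  rw [equation_iff]
  simp only [Cubic.toPoly, IsRoot.def, eval_add, eval_mul, eval_C, eval_pow, eval_X] at hy
  linear_combination hy

variable [DecidableEq F]

variable (W) in
/-- The pair of polynomials `(A, D)` computes the `x`-coordinate of `n • P` from that of `P`,
as a point of the projective line, and has the expected degrees and leading coefficients. -/
structure IsMultiplication (n : ℕ) (A D : F[X]) : Prop where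
  monic : A.Monic
  natDegree : A.natDegree = n ^ 2
  natDegree_le : D.natDegree ≤ n ^ 2 - 1
  coeff : D.coeff (n ^ 2 - 1) = (n : F) ^ 2
  xRep : ∀ {x y : F} (h : W.toAffine.Nonsingular x y),
    ∃ c : F, c ≠ 0 ∧ A.eval x = c * (n • some x y h).xRep 0 ∧
      D.eval x = c * (n • some x y h).xRep 1

lemma isMultiplication_one : IsMultiplication W 1 X 1 where
  monic := monic_X
  natDegree := by simp
  natDegree_le := by simp
  coeff := by simp
  xRep h := ⟨1, one_ne_zero, by simp, by simp⟩

lemma isMultiplication_two [W.IsElliptic] : IsMultiplication W 2 (W.Φ 2) (W.ΨSq 2) where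
  monic := by
    have := W.leadingCoeff_Φ 2
    exact this
  natDegree := by simpa using W.natDegree_Φ 2
  natDegree_le := by simpa using W.natDegree_ΨSq_le 2
  coeff := by simpa using W.coeff_ΨSq 2
  xRep {x y} h := by
    obtain ⟨c, hc, h'⟩ := sym2x_add_self (W := W) (some x y h)
    refine ⟨c, hc, ?_, ?_⟩
    · have := congrFun h' 0
      rw [congrFun (eval_addSubMap _) 0] at this
      rw [two_nsmul, Φ_two]
      simp [sym2x] at this ⊢
      rw [← this]
      ring
    · have := congrFun h' 1
      rw [congrFun (eval_addSubMap _) 1] at this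
      rw [two_nsmul, ΨSq_two, Ψ₂Sq]
      simp [sym2x] at this ⊢
      rw [← this]
      ring

namespace IsMultiplication

variable {n : ℕ} {A D A' D' : F[X]}

/-- Every `x` lifts to a point, and at a common root both homogeneous coordinates of the multiple of
that point would vanish. -/
lemma isCoprime [IsAlgClosed F] [W.IsElliptic] (h : IsMultiplication W n A D) : IsCoprime A D := by
  rw [Polynomial.isCoprime_iff_aeval_ne_zero_of_isAlgClosed F F]
  intro x
  obtain ⟨y, hxy⟩ := exists_nonsingular (W := W) x
  obtain ⟨c, hc, h0, h1⟩ := h.xRep hxy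
  by_contra! hcon
  simp only [coe_aeval_eq_eval] at hcon
  rw [h0, h1] at hcon
  apply xRep_ne_zero (n • some x y hxy)
  ext i
  fin_cases i
  · simpa [hc] using hcon.1
  · simpa [hc] using hcon.2

lemma right_ne_zero [IsAlgClosed F] [W.IsElliptic] (h : IsMultiplication W n A D) (hn : n ≠ 0) : D ≠ 0 := by
  rintro rfl
  have h1 := isCoprime_zero_right.1 h.isCoprime
  have h2 := natDegree_eq_zero_of_isUnit h1
  rw [h.natDegree] at h2
  exact hn (by simpa using h2)

variable (W) in
/-- The numerators of the product and the sum of the `x`-coordinates of `P + Q` and `P - Q`, and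
their common denominator, if `P` has `x`-coordinate `A / D` and `Q` has `x`-coordinate `X`. -/
def addSubPoly (A D : F[X]) : Fin 3 → F[X] :=
  ![(X * A) ^ 2 - C W.b₄ * (X * A) * D - C W.b₆ * (A + X * D) * D - C W.b₈ * D ^ 2,
    2 * (A + X * D) * (X * A) + C W.b₂ * (X * A) * D + C W.b₄ * (A + X * D) * D + C W.b₆ * D ^ 2,
    (A - X * D) ^ 2]

lemma eval_addSubPoly [W.IsElliptic] (h : IsMultiplication W n A D) {x y : F}
    (hxy : W.toAffine.Nonsingular x y) :
    ∃ c : F, c ≠ 0 ∧ ∀ i, (addSubPoly W A D i).eval x =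
      c * ((n + 1) • some x y hxy).sym2x ((n : ℤ) • some x y hxy - some x y hxy) i := by
  obtain ⟨c, hc, h0, h1⟩ := h.xRep hxy
  obtain ⟨d, hd, h2⟩ := addSubMap_sym2x (n • some x y hxy) (some x y hxy)
  -- The forms are quadratic, so rescaling the representative of `n • P` by `c` contributes `c ^ 2`.
  refine ⟨c ^ 2 * d, mul_ne_zero (pow_ne_zero 2 hc) hd, fun i => ?_⟩
  have h3 := congrFun h2 i
  rw [congrFun (eval_addSubMap _) i, Pi.smul_apply, smul_eq_mul] at h3
  rw [mul_assoc, add_smul, one_smul, natCast_zsmul, ← h3]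
  fin_cases i <;> simp [addSubPoly, sym2x, h0, h1] <;> ring

/-- The three polynomials represent the symmetric product of the x-coordinates of `(n + 2)P` and
`nP`. Since `nP` is known as `(A' : D')`, coprimality allows this factor to be divided out. -/
lemma exists_addSubPoly_eq [IsAlgClosed F] [W.IsElliptic] (hn : n ≠ 0)
    (h' : IsMultiplication W n A' D') (h : IsMultiplication W (n + 1) A D) :
    ∃ A'' D'' : F[X], addSubPoly W A D = ![A'' * A', A'' * D' + D'' * A', D'' * D'] := by
  -- The binary quadratic form with roots `(n + 2)P` and `nP` vanishes at `(A' : D')`. It suffices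
  -- to check this at each `x`, as the field is infinite.
  have key : addSubPoly W A D 2 * A' ^ 2 - addSubPoly W A D 1 * A' * D' +
      addSubPoly W A D 0 * D' ^ 2 = 0 := by
    refine Polynomial.funext fun x => ?_
    obtain ⟨y, hxy⟩ := exists_nonsingular (W := W) x
    obtain ⟨c, hc, h1⟩ := h.eval_addSubPoly hxy
    obtain ⟨d, hd, h2, h3⟩ := h'.xRep hxy
    have e : ((n + 1 : ℕ) : ℤ) • some x y hxy - some x y hxy = n • some x y hxy := by
      rw [natCast_zsmul, add_smul, one_smul, add_sub_cancel_right]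
    rw [e] at h1
    simp only [eval_add, eval_sub, eval_mul, eval_pow, h1, h2, h3, eval_zero, sym2x,
      Matrix.cons_val_zero, Matrix.cons_val_one, Matrix.cons_val]
    ring
  have hA' : A' ≠ 0 := h'.monic.ne_zero
  have hD' : D' ≠ 0 := h'.right_ne_zero hn
  obtain ⟨D'', hD''⟩ : D' ∣ addSubPoly W A D 2 := by
    refine (h'.isCoprime.symm.pow_right (n := 2)).dvd_of_dvd_mul_right
      ⟨addSubPoly W A D 1 * A' - addSubPoly W A D 0 * D', ?_⟩
    linear_combination key
  obtain ⟨A'', hA''⟩ : A' ∣ addSubPoly W A D 0 := by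
    refine (h'.isCoprime.pow_right (n := 2)).dvd_of_dvd_mul_right
      ⟨addSubPoly W A D 1 * D' - addSubPoly W A D 2 * A', ?_⟩
    linear_combination key
  have h1 : addSubPoly W A D 1 = A'' * D' + D'' * A' := by
    rw [hD'', hA''] at key
    have : A' * D' * (addSubPoly W A D 1 - (A'' * D' + D'' * A')) = 0 := by
      linear_combination -key
    exact sub_eq_zero.1 ((mul_eq_zero.1 this).resolve_left (mul_ne_zero hA' hD'))
  refine ⟨A'', D'', ?_⟩
  ext1 i
  fin_cases i
  · simpa [mul_comm] using hA''
  · simpa using h1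
  · simpa [mul_comm] using hD''

lemma xRep_of_mul_eq [W.IsElliptic] {A'' D'' : F[X]} (h' : IsMultiplication W n A' D')
    (h : IsMultiplication W (n + 1) A D)
    (he : addSubPoly W A D = ![A'' * A', A'' * D' + D'' * A', D'' * D'])
    {x y : F} (hxy : W.toAffine.Nonsingular x y) :
    ∃ c : F, c ≠ 0 ∧ A''.eval x = c * ((n + 2) • some x y hxy).xRep 0 ∧
      D''.eval x = c * ((n + 2) • some x y hxy).xRep 1 := by
  obtain ⟨c, hc, h1⟩ := h.eval_addSubPoly hxy
  obtain ⟨d, hd, h2, h3⟩ := h'.xRep hxy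
  have e : ((n + 1 : ℕ) : ℤ) • some x y hxy - some x y hxy = n • some x y hxy := by
    rw [natCast_zsmul, add_smul, one_smul, add_sub_cancel_right]
  rw [e, he] at h1
  have e0 := h1 0
  have e1 := h1 1
  have e2 := h1 2
  simp only [eval_add, eval_mul, h2, h3, sym2x,
      Matrix.cons_val_zero, Matrix.cons_val_one, Matrix.cons_val] at e0 e1 e2
  refine ⟨c / d, div_ne_zero hc hd, ?_⟩
  clear h1 h2 h3 e
  generalize n • some x y hxy = R at e0 e1 e2
  -- If `nP = 0` its representative is `(1, 0)`, and the first two forms give the coordinates of `(n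
  -- + 2)P`. Otherwise it is `(x', 1)`, and they come from the last two.
  rcases R with _ | ⟨x', y', hxy'⟩
  · rw [← zero_def, xRep_zero] at e0 e1 e2
    simp at e0 e1 e2
    constructor
    · field_simp
      linear_combination e0
    · field_simp
      linear_combination e1
  · simp only [xRep_some, Matrix.cons_val_zero, Matrix.cons_val_one] at e0 e1 e2
    constructor
    · field_simp
      linear_combination e1 - x' * e2
    · field_simp
      linear_combination e2

/-- The degrees follow from `(n + 2)² + n² = 2(n + 1)² + 2`: the top term of `addSubPoly` comes from
`(X * A) ^ 2`, and the factor `A'` is monic of degree `n²`. -/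
lemma exists_add_two [IsAlgClosed F] [W.IsElliptic] (hn : n ≠ 0)
    (h' : IsMultiplication W n A' D') (h : IsMultiplication W (n + 1) A D) :
    ∃ A'' D'' : F[X], IsMultiplication W (n + 2) A'' D'' := by
  obtain ⟨A'', D'', he⟩ := exists_addSubPoly_eq hn h' h
  -- Naming the squares minus one removes truncated subtraction from the degree bookkeeping.
  obtain ⟨N, hN⟩ : ∃ N, (n + 1) ^ 2 = N + 1 := ⟨n ^ 2 + 2 * n, by ring⟩
  obtain ⟨N', hN'⟩ : ∃ N', n ^ 2 = N' + 1 :=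
    ⟨n ^ 2 - 1, (Nat.succ_pred (pow_ne_zero 2 hn)).symm⟩
  obtain ⟨N'', hN''⟩ : ∃ N'', (n + 2) ^ 2 = N'' + 1 := ⟨n ^ 2 + 4 * n + 3, by ring⟩
  have hNN : N'' + N' + 1 = 2 * N + 3 := by nlinarith
  have dA := h.natDegree
  have dD := h.natDegree_le
  have cD := h.coeff
  have dA' := h'.natDegree
  have dD' := h'.natDegree_le
  have cD' := h'.coeff
  have mA := h.monic
  have mA' := h'.monic
  rw [hN] at dA dD cD
  rw [hN'] at dA' dD' cD'
  simp only [Nat.add_sub_cancel] at dD cD dD' cD'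
  have hX : (X * A).Monic := monic_X.mul mA
  have dXA : (X * A).natDegree = N + 2 := by
    rw [monic_X.natDegree_mul mA, natDegree_X, dA]; ring
  have dAD : (A + X * D).natDegree ≤ N + 1 := by
    refine natDegree_add_le_of_degree_le dA.le (natDegree_mul_le.trans ?_)
    rw [natDegree_X]; omega
  have cAD : (A + X * D).coeff (N + 1) = ((n : F) + 1) ^ 2 + 1 := by
    have : A.coeff (N + 1) = 1 := by rw [← dA]; exact mA
    rw [coeff_add, this, coeff_X_mul, cD]
    push_cast; ring
  have hC : ∀ (b : F) (p : F[X]), (C b * p).natDegree ≤ p.natDegree := fun b p =>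
    natDegree_C_mul_le b p
  have dXAD : ∀ b : F, (C b * (X * A) * D).natDegree ≤ 2 * N + 2 := fun b =>
    natDegree_mul_le.trans (by have := hC b (X * A); omega)
  have dADD : ∀ b : F, (C b * (A + X * D) * D).natDegree ≤ 2 * N + 2 := fun b =>
    natDegree_mul_le.trans (by have := hC b (A + X * D); omega)
  have dDD : ∀ b : F, (C b * D ^ 2).natDegree ≤ 2 * N + 2 := fun b =>
    (hC b _).trans (natDegree_pow_le.trans (by omega))
  have e0 : A'' * A' = _ := (congrFun he 0).symm
  have e1 : A'' * D' + D'' * A' = _ := (congrFun he 1).symm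
  simp only [addSubPoly, Matrix.cons_val_zero, Matrix.cons_val_one] at e0 e1
  have dXA2 : ((X * A) ^ 2).natDegree = 2 * N + 4 := by rw [hX.natDegree_pow, dXA]; ring
  have e0' : A'' * A' = (X * A) ^ 2 - (C W.b₄ * (X * A) * D + C W.b₆ * (A + X * D) * D +
      C W.b₈ * D ^ 2) := by rw [e0]; ring
  have dR : (C W.b₄ * (X * A) * D + C W.b₆ * (A + X * D) * D + C W.b₈ * D ^ 2).natDegree <
      ((X * A) ^ 2).natDegree := by
    refine (natDegree_add_le_of_degree_le (natDegree_add_le_of_degree_le (dXAD _) (dADD _))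
      (dDD _)).trans_lt ?_
    omega
  have mg : (A'' * A').Monic := by
    rw [e0']
    exact (hX.pow 2).sub_of_left (degree_lt_degree dR)
  have dg : (A'' * A').natDegree = 2 * N + 4 := by
    rw [e0', natDegree_sub_eq_left_of_natDegree_lt dR, dXA2]
  have mA'' : A''.Monic := mA'.of_mul_monic_right mg
  have dA'' : A''.natDegree = N'' + 1 := by
    rw [mA''.natDegree_mul mA', dA'] at dg
    omega
  have dg1 : (2 * (A + X * D) * (X * A)).natDegree ≤ 2 * N + 3 := by
    rw [mul_assoc]
    refine (natDegree_C_mul_le (2 : F) _).trans (natDegree_mul_le.trans ?_)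
    omega
  have cg1 : (2 * (A + X * D) * (X * A)).coeff (2 * N + 3) = 2 * (((n : F) + 1) ^ 2 + 1) := by
    have h1 : (X * A).coeff (N + 2) = 1 := by rw [← dXA]; exact hX
    have h2 : (2 : F[X]) * (A + X * D) * (X * A) = C 2 * ((A + X * D) * (X * A)) := by
      rw [mul_assoc]; rfl
    rw [h2, coeff_C_mul, show 2 * N + 3 = (N + 1) + (N + 2) by ring,
      coeff_mul_add_eq_of_natDegree_le dAD dXA.le, cAD, h1, mul_one]
  have dr1 : (C W.b₂ * (X * A) * D + C W.b₄ * (A + X * D) * D + C W.b₆ * D ^ 2).natDegree ≤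
      2 * N + 2 :=
    natDegree_add_le_of_degree_le (natDegree_add_le_of_degree_le (dXAD _) (dADD _)) (dDD _)
  have e2 : D'' * A' = 2 * (A + X * D) * (X * A) + (C W.b₂ * (X * A) * D +
      C W.b₄ * (A + X * D) * D + C W.b₆ * D ^ 2) - A'' * D' := by
    linear_combination e1
  have dAD' : (A'' * D').natDegree ≤ 2 * N + 3 := natDegree_mul_le.trans (by omega)
  have dDA : (D'' * A').natDegree ≤ 2 * N + 3 := by
    rw [e2]
    exact (natDegree_sub_le_of_le (natDegree_add_le_of_degree_le dg1 (dr1.trans (by omega)))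
      dAD').trans (max_self _).le
  have dD'' : D''.natDegree ≤ N'' := by
    rcases eq_or_ne D'' 0 with rfl | h0
    · simp
    · rw [natDegree_mul h0 mA'.ne_zero, dA'] at dDA
      omega
  refine ⟨A'', D'', mA'', dA''.trans hN''.symm, ?_, ?_, fun hxy => xRep_of_mul_eq h' h he hxy⟩
  · rw [hN'']; exact dD''
  · have h1 : A'.coeff (N' + 1) = 1 := by rw [← dA']; exact mA'
    have h2 : A''.coeff (N'' + 1) = 1 := by rw [← dA'']; exact mA''
    -- Comparing coefficients in degree `2N + 3` gives `2((n + 1)² + 1) - n² = (n + 2)²`.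
    have h3 := congrArg (Polynomial.coeff · (2 * N + 3)) e2
    rw [coeff_sub, coeff_add, cg1, coeff_eq_zero_of_natDegree_lt (dr1.trans_lt (by omega)),
      show 2 * N + 3 = N'' + (N' + 1) by omega, coeff_mul_add_eq_of_natDegree_le dD'' dA'.le, h1,
      show N'' + (N' + 1) = (N'' + 1) + N' by omega,
      coeff_mul_add_eq_of_natDegree_le dA''.le dD', h2, cD'] at h3
    rw [hN'', Nat.add_sub_cancel]
    push_cast
    linear_combination h3

end IsMultiplication

theorem exists_isMultiplication [IsAlgClosed F] [W.IsElliptic] {n : ℕ} (hn : n ≠ 0) :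
    ∃ A D : F[X], IsMultiplication W n A D := by
  -- The recursion needs two consecutive values and divides by `D'`, which is nonzero only for `n ≠
  -- 0`; hence the start at 1 and 2.
  have key : ∀ m : ℕ, (∃ A D : F[X], IsMultiplication W (m + 1) A D) ∧
      ∃ A D : F[X], IsMultiplication W (m + 2) A D := by
    intro m
    induction m with
    | zero => exact ⟨⟨_, _, isMultiplication_one⟩, _, _, isMultiplication_two⟩
    | succ m ih =>
      obtain ⟨⟨A', D', h'⟩, A, D, h⟩ := ih
      exact ⟨⟨A, D, h⟩, h'.exists_add_two m.succ_ne_zero h⟩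
  obtain ⟨m, rfl⟩ := Nat.exists_eq_succ_of_ne_zero hn
  exact (key m).1

/-- Multiplication by a nonzero integer is surjective on the points over an algebraically closed
field. -/
theorem nsmul_surjective [IsAlgClosed F] [W.IsElliptic] {n : ℕ} (hn : n ≠ 0) (Q : W.toAffine.Point) :
    ∃ P : W.toAffine.Point, n • P = Q := by
  rcases Q with _ | ⟨x, y, h⟩
  · exact ⟨0, smul_zero _⟩
  obtain ⟨A, D, hAD⟩ := exists_isMultiplication (W := W) hn
  -- As `A` has strictly larger degree than `D`, the equation `A = x * D` keeps degree `n²` and has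
  -- a root.
  have hlt : (C x * D).natDegree < A.natDegree := by
    have h1 := natDegree_C_mul_le x D
    have h2 := hAD.natDegree_le
    have h3 := hAD.natDegree
    have : 0 < n ^ 2 := by positivity
    omega
  have hdeg : (A - C x * D).degree ≠ 0 := by
    rw [degree_sub_eq_left_of_degree_lt (degree_lt_degree hlt),
      degree_eq_natDegree hAD.monic.ne_zero, hAD.natDegree]
    exact_mod_cast pow_ne_zero 2 hn
  obtain ⟨x₀, hx₀⟩ := IsAlgClosed.exists_root _ hdeg
  obtain ⟨y₀, hxy⟩ := exists_nonsingular (W := W) x₀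
  obtain ⟨c, hc, h0, h1⟩ := hAD.xRep hxy
  have hr : (n • some x₀ y₀ hxy).xRep 0 = x * (n • some x₀ y₀ hxy).xRep 1 := by
    apply mul_left_cancel₀ hc
    simp only [IsRoot.def, eval_sub, eval_mul, eval_C] at hx₀
    linear_combination hx₀ - h0 + x * h1
  have hx : (n • some x₀ y₀ hxy).xRep = (some x y h).xRep := by
    revert hr
    generalize n • some x₀ y₀ hxy = R
    intro hr
    -- If the multiple were the point at infinity, with representative `(1, 0)`, `hr` would read `1
    -- = x * 0`.
    rcases R with _ | ⟨x', y', h'⟩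
    · rw [← zero_def] at hr
      simp at hr
    · have : x' = x := by simpa using hr
      simp [this]
  rcases eq_or_eq_neg_of_xRep_eq_xRep hx with h2 | h2
  · exact ⟨_, h2⟩
  · exact ⟨-some x₀ y₀ hxy, by rw [smul_neg, h2, neg_neg]⟩

/-- There is nontrivial `n`-torsion if `n` is prime to the characteristic. -/
theorem exists_ne_zero_nsmul_eq_zero [IsAlgClosed F] [W.IsElliptic] {n : ℕ} (hn : 1 < n)
    (hF : (n : F) ≠ 0) : ∃ P : W.toAffine.Point, P ≠ 0 ∧ n • P = 0 := by
  obtain ⟨A, D, h⟩ := exists_isMultiplication (W := W) (n := n) (by omega)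
  have hdeg : D.degree ≠ 0 := by
    -- The coefficient in degree `n² - 1 > 0` is `n² ≠ 0`, so `D` is not constant. At a root of `D`
    -- the second coordinate of `n • P` vanishes, that is, `n • P = 0`.
    intro h0
    have h1 := h.coeff
    rw [eq_C_of_degree_eq_zero h0, coeff_C_of_ne_zero] at h1
    · exact pow_ne_zero 2 hF h1.symm
    · have := Nat.one_lt_pow two_ne_zero hn
      omega
  obtain ⟨x, hx⟩ := IsAlgClosed.exists_root _ hdeg
  obtain ⟨y, hxy⟩ := exists_nonsingular (W := W) x
  refine ⟨some x y hxy, some_ne_zero _, ?_⟩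
  obtain ⟨c, hc, -, h1⟩ := h.xRep hxy
  rw [hx] at h1
  revert h1
  generalize n • some x y hxy = R
  intro h1
  rcases R with _ | ⟨x', y', h'⟩
  · rfl
  · simp at h1
    exact absurd h1.symm hc

/-- A bound for the number of `n`-torsion points. -/
theorem finite_torsion [IsAlgClosed F] [W.IsElliptic] {n : ℕ} (hn : n ≠ 0) :
    {P : W.toAffine.Point | n • P = 0}.Finite ∧
      {P : W.toAffine.Point | n • P = 0}.ncard ≤ 2 * n ^ 2 - 1 := by
  classical
  obtain ⟨A, D, h⟩ := exists_isMultiplication (W := W) hn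
  choose y hy using exists_nonsingular (W := W)
  set T : Finset W.toAffine.Point := insert 0 (D.roots.toFinset.biUnion fun x =>
    {some x (y x) (hy x), -some x (y x) (hy x)}) with hT
  have hsub : {P : W.toAffine.Point | n • P = 0} ⊆ T := by
    rintro (_ | ⟨x, y', hxy⟩) hP
    · simp [hT, ← zero_def]
    · obtain ⟨c, hc, -, h1⟩ := h.xRep hxy
      have hP' : n • some x y' hxy = 0 := hP
      rw [hP', xRep_zero] at h1
      have hx : x ∈ D.roots.toFinset := by
        rw [Multiset.mem_toFinset, mem_roots (h.right_ne_zero hn), IsRoot.def, h1]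
        simp
      have h2 : some x y' hxy = some x (y x) (hy x) ∨ some x y' hxy = -some x (y x) (hy x) :=
        eq_or_eq_neg_of_xRep_eq_xRep (by simp)
      rw [hT, Finset.coe_insert]
      refine Set.mem_insert_of_mem _ ?_
      simp only [Finset.mem_coe, Finset.mem_biUnion, Finset.mem_insert, Finset.mem_singleton]
      exact ⟨x, hx, h2⟩
  -- The point at infinity and two points for each of at most `n² - 1` roots. This crude count is
  -- enough to bound the rank of the Tate module.
  have hcard : T.card ≤ 2 * n ^ 2 - 1 := by
    have h1 : D.roots.toFinset.card ≤ n ^ 2 - 1 :=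
      (Multiset.toFinset_card_le _).trans ((card_roots' D).trans h.natDegree_le)
    have h2 := Finset.card_biUnion_le_card_mul D.roots.toFinset (fun x =>
      {some x (y x) (hy x), -some x (y x) (hy x)}) 2 fun x _ => Finset.card_le_two
    have h3 := Finset.card_insert_le (0 : W.toAffine.Point) (D.roots.toFinset.biUnion fun x =>
      {some x (y x) (hy x), -some x (y x) (hy x)})
    have : 0 < n ^ 2 := by positivity
    rw [← hT] at h3
    omega
  refine ⟨T.finite_toSet.subset hsub, (Set.ncard_le_ncard hsub T.finite_toSet).trans ?_⟩
  rwa [Set.ncard_coe_finset]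

end WeierstrassCurve.Affine.Point

end

/-! ### Structure of the Tate module over the ℓ-adic integers. -/

noncomputable section

namespace ArithSpin

open Module

/-- A finite power of a ring which is complete for a principal ideal is complete. -/
lemma isPrecomplete_pi_span_singleton {R ι : Type*} [CommRing R] (a : R)
    [IsPrecomplete (Ideal.span {a}) R] : IsPrecomplete (Ideal.span {a}) (ι → R) := by
  refine ⟨fun f hf => ?_⟩
  have h : ∀ i, ∃ L : R, ∀ n, f n i ≡ L [SMOD (Ideal.span {a} ^ n • ⊤ : Submodule R R)] := by
    intro i
    refine IsPrecomplete.prec' (fun n => f n i) fun {m n} hmn => ?_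
    have h1 := hf hmn
    rw [SModEq.sub_mem, Ideal.span_singleton_pow, Submodule.ideal_span_singleton_smul,
      Submodule.mem_smul_pointwise_iff_exists] at h1 ⊢
    obtain ⟨y, -, hy⟩ := h1
    exact ⟨y i, trivial, congrFun hy i⟩
  choose L hL using h
  refine ⟨L, fun n => ?_⟩
  -- For a principal ideal, congruence modulo its `n`-th power means divisibility by `a ^ n`, so
  -- coordinatewise witnesses assemble to a vector.
  have h2 : ∀ i, ∃ y : R, a ^ n • y = f n i - L i := by
    intro i
    have h1 := hL i n
    rw [SModEq.sub_mem, Ideal.span_singleton_pow, Submodule.ideal_span_singleton_smul,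
      Submodule.mem_smul_pointwise_iff_exists] at h1
    obtain ⟨y, -, hy⟩ := h1
    exact ⟨y, hy⟩
  choose y hy using h2
  rw [SModEq.sub_mem, Ideal.span_singleton_pow, Submodule.ideal_span_singleton_smul,
    Submodule.mem_smul_pointwise_iff_exists]
  exact ⟨y, trivial, funext hy⟩

variable {M : Type*} [AddCommGroup M] {ℓ : ℕ}

/-- The Tate module is nonzero if the group is `ℓ`-divisible with nonzero `ℓ`-torsion. -/
lemma nontrivial_tateModule (hdiv : ∀ Q : M, ∃ P, ℓ • P = Q) (htors : ∃ P : M, P ≠ 0 ∧ ℓ • P = 0) :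
    Nontrivial (tateModule M ℓ) := by
  choose f hf using hdiv
  obtain ⟨P, hP, hP'⟩ := htors
  -- The sequence is `0, P, f P, f (f P), …`; its component of index 1 is the chosen torsion point.
  let s : ℕ → M := fun n => Nat.rec 0 (fun n Q => if n = 0 then P else f Q) n
  have h1 : s 1 = P := rfl
  refine ⟨⟨⟨s, rfl, fun n => ?_⟩, 0, fun h => hP ?_⟩⟩
  · rcases n with _ | n
    · exact hP'
    · exact hf _
  · rw [← h1]
    exact congrFun (congrArg Subtype.val h) 1

variable [Fact ℓ.Prime]

lemma tateModule_natCast_smul_apply (a : ℕ) (P : tateModule M ℓ) (n : ℕ) :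
    ((a : ℤ_[ℓ]) • P).1 n = a • P.1 n := by
  rw [Nat.cast_smul_eq_nsmul]
  rfl

/-- Division by `ℓ` is a shift of the sequence, and the hypothesis is what makes the shifted
sequence start at zero. Hence the Tate module modulo `ℓ` embeds in the `ℓ`-torsion. -/
lemma tateModule_exists_smul_eq {P : tateModule M ℓ} (h : P.1 1 = 0) :
    ∃ Q : tateModule M ℓ, (ℓ : ℤ_[ℓ]) • Q = P := by
  refine ⟨⟨fun n => P.1 (n + 1), h, fun n => P.2.2 (n + 1)⟩, Subtype.ext (funext fun n => ?_)⟩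
  rw [tateModule_natCast_smul_apply]
  exact P.2.2 n

lemma tateModule_smul_apply_one (P : tateModule M ℓ) : ((ℓ : ℤ_[ℓ]) • P).1 1 = 0 := by
  rw [tateModule_natCast_smul_apply, P.2.2 0, P.2.1]

instance isHausdorff_tateModule : IsHausdorff (Ideal.span {(ℓ : ℤ_[ℓ])}) (tateModule M ℓ) := by
  refine ⟨fun P hP => Subtype.ext (funext fun n => ?_)⟩
  have h := hP n
  rw [SModEq.zero, Ideal.span_singleton_pow, Submodule.ideal_span_singleton_smul,
    Submodule.mem_smul_pointwise_iff_exists] at h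
  obtain ⟨Q, -, rfl⟩ := h
  rw [← Nat.cast_pow, tateModule_natCast_smul_apply, tateModule_torsion]
  rfl

lemma tateModule_smul_injective {P : tateModule M ℓ} (h : (ℓ : ℤ_[ℓ]) • P = 0) : P = 0 := by
  refine Subtype.ext (funext fun n => ?_)
  rw [← P.2.2 n, ← tateModule_natCast_smul_apply, h]
  rfl

instance : IsTorsionFree ℤ_[ℓ] (tateModule M ℓ) := by
  refine .of_smul_eq_zero fun a P h => ?_
  by_contra! hcon
  obtain ⟨ha, hP⟩ := hcon
  -- A nonzero `ℓ`-adic integer is a unit times a power of `ℓ`, so only `ℓ`-torsion has to be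
  -- excluded.
  rw [PadicInt.unitCoeff_spec ha, mul_smul, ← Units.smul_def, smul_eq_zero_iff_eq] at h
  apply hP
  revert h
  generalize a.valuation = n
  intro h
  induction n with
  | zero => simpa using h
  | succ n ih =>
    rw [pow_succ', mul_smul] at h
    exact ih (tateModule_smul_injective h)

instance : IsPrecomplete (Ideal.span {(ℓ : ℤ_[ℓ])}) ℤ_[ℓ] := by
  rw [← PadicInt.maximalIdeal_eq_span_p]
  infer_instance

/-- The Tate module is finitely generated if the `ℓ`-torsion is finite. -/
lemma finite_tateModule (hfin : {P : M | ℓ • P = 0}.Finite) :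
    Module.Finite ℤ_[ℓ] (tateModule M ℓ) := by
  have : Finite {P : M | ℓ • P = 0} := hfin
  have hmem : ∀ P : tateModule M ℓ, P.1 1 ∈ {P : M | ℓ • P = 0} := fun P => by
    have := tateModule_torsion P 1
    rwa [pow_one] at this
  -- Only torsion points that lift to the Tate module are indexed. Their lifts generate modulo `ℓ`,
  -- and completeness of the source with separatedness of the target gives generation.
  let ι := Set.range fun P : tateModule M ℓ => (⟨P.1 1, hmem P⟩ : {P : M | ℓ • P = 0})
  have : Fintype ι := Fintype.ofFinite ι
  choose g hg using fun i : ι => i.2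
  have : IsPrecomplete (Ideal.span {(ℓ : ℤ_[ℓ])}) (ι → ℤ_[ℓ]) := isPrecomplete_pi_span_singleton _
  refine Module.Finite.of_surjective (Fintype.linearCombination ℤ_[ℓ] g)
    (surjective_of_mkQ_comp_surjective (I := Ideal.span {(ℓ : ℤ_[ℓ])}) ?_)
  intro q
  obtain ⟨P, rfl⟩ := Submodule.mkQ_surjective _ q
  classical
  let i : ι := ⟨_, P, rfl⟩
  refine ⟨Pi.single i 1, ?_⟩
  rw [LinearMap.comp_apply, Fintype.linearCombination_apply_single, one_smul, ← sub_eq_zero,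
    ← map_sub, Submodule.mkQ_apply, Submodule.Quotient.mk_eq_zero,
    Submodule.ideal_span_singleton_smul, Submodule.mem_smul_pointwise_iff_exists]
  have h1 : (g i).1 1 = P.1 1 := congrArg Subtype.val (hg i)
  obtain ⟨Q, hQ⟩ := tateModule_exists_smul_eq (P := g i - P) (sub_eq_zero.2 h1)
  exact ⟨Q, trivial, hQ⟩

/-- The rank of the Tate module is bounded by that of the `ℓ`-torsion. -/
lemma pow_finrank_tateModule_le (hfin : {P : M | ℓ • P = 0}.Finite) :
    ℓ ^ finrank ℤ_[ℓ] (tateModule M ℓ) ≤ {P : M | ℓ • P = 0}.ncard := by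
  have := finite_tateModule hfin
  set d := finrank ℤ_[ℓ] (tateModule M ℓ) with hd
  let b := Module.finBasis ℤ_[ℓ] (tateModule M ℓ)
  -- Residues are lifted to integer coefficients. Two such combinations with equal first components
  -- differ by a multiple of `ℓ`, so their residues agree.
  let φ : (Fin d → ZMod ℓ) → tateModule M ℓ := fun v => ∑ i, ((v i).val : ℤ_[ℓ]) • b i
  have hinj : Function.Injective fun v => (φ v).1 1 := by
    intro v w hvw
    obtain ⟨Q, hQ⟩ := tateModule_exists_smul_eq (P := φ v - φ w) (sub_eq_zero.2 hvw)
    funext i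
    have h1 := congrArg (fun P => b.repr P i) hQ
    simp only [φ, map_sub, map_smul, map_sum, Finsupp.smul_apply, Finsupp.sub_apply,
      Finsupp.finsetSum_apply, Basis.repr_self, Finsupp.single_apply, smul_eq_mul, mul_ite,
      mul_one, mul_zero, Finset.sum_ite_eq', Finset.mem_univ, if_true] at h1
    have h2 := congrArg PadicInt.toZMod h1
    rw [map_mul, map_natCast, CharP.cast_eq_zero, zero_mul, map_sub, map_natCast, map_natCast,
      ZMod.natCast_zmod_val, ZMod.natCast_zmod_val] at h2
    exact (sub_eq_zero.1 h2.symm)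
  have h1 : Nat.card (Fin d → ZMod ℓ) = ℓ ^ d := by simp
  rw [← h1, ← Set.ncard_univ, ← Set.ncard_image_of_injective _ hinj]
  refine Set.ncard_le_ncard ?_ hfin
  rintro _ ⟨v, -, rfl⟩
  have := tateModule_torsion (φ v) 1
  rwa [pow_one] at this

end ArithSpin

end

/-! ### Central simple algebras under base change. -/

noncomputable section

namespace ArithSpin

open Module TensorProduct

section CentralSimple

variable (K : Type*) (L : Type*) (B : Type*) [Field K] [Field L] [Algebra K L] [Ring B] [Algebra K B]

variable {K L B} in
lemma equivFinsuppOfBasisLeft_mul_left {ι : Type*} [DecidableEq ι] (b : Basis ι K L) (c : B)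
    (x : L ⊗[K] B) (i : ι) :
    TensorProduct.equivFinsuppOfBasisLeft b ((1 ⊗ₜ c) * x) i =
      c * TensorProduct.equivFinsuppOfBasisLeft b x i := by
  induction x using TensorProduct.induction_on with
  | zero => simp
  | tmul l d => simp
  | add x y hx hy =>
    rw [mul_add, map_add, map_add, Finsupp.add_apply, Finsupp.add_apply, hx, hy, mul_add]

variable {K L B} in
lemma equivFinsuppOfBasisLeft_mul_right {ι : Type*} [DecidableEq ι] (b : Basis ι K L) (c : B)
    (x : L ⊗[K] B) (i : ι) :
    TensorProduct.equivFinsuppOfBasisLeft b (x * (1 ⊗ₜ c)) i =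
      TensorProduct.equivFinsuppOfBasisLeft b x i * c := by
  induction x using TensorProduct.induction_on with
  | zero => simp
  | tmul l d => simp
  | add x y hx hy =>
    rw [add_mul, map_add, map_add, Finsupp.add_apply, Finsupp.add_apply, hx, hy, add_mul]

/-- A central simple algebra remains simple after an extension of the base field. -/
instance isSimpleRing_baseChange [Algebra.IsCentral K B] [IsSimpleRing B] :
    IsSimpleRing (L ⊗[K] B) := by
  classical
  let b := Basis.ofVectorSpace K L
  let e := TensorProduct.equivFinsuppOfBasisLeft (M := L) (N := B) b
  have : Nontrivial (L ⊗[K] B) := inferInstance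
  refine ⟨⟨fun I => or_iff_not_imp_left.2 fun hI => ?_⟩⟩
  -- Shortest-element argument: take a nonzero element of `I` with the fewest nonzero coordinates
  -- along a basis of `L` over `K`.
  have hex : ∃ m, ∃ x ∈ I, x ≠ 0 ∧ (e x).support.card = m := by
    by_contra! hcon
    apply hI
    rw [eq_bot_iff]
    intro x hx
    by_contra hx0
    exact hcon _ x hx (fun h => hx0 ((TwoSidedIdeal.mem_bot _).2 h)) rfl
  obtain ⟨x, hxI, hx0, hxm⟩ := Nat.find_spec hex
  have hmin : ∀ y ∈ I, (e y).support.card < Nat.find hex → y = 0 := by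
    intro y hy hlt
    by_contra hy0
    exact Nat.find_min hex hlt ⟨y, hy, hy0, rfl⟩
  obtain ⟨i, hi⟩ : ∃ i, e x i ≠ 0 := by
    by_contra! hcon
    exact hx0 (e.injective (by rw [map_zero]; exact Finsupp.ext hcon))
  -- The `i`-th coordinates of elements of `I` supported where `x` is form a two-sided ideal of `B`.
  -- It is nonzero, hence everything, so the `i`-th coordinate can be normalised to 1.
  let J : TwoSidedIdeal B := TwoSidedIdeal.mk' {c | ∃ y ∈ I, (e y).support ⊆ (e x).support ∧ e y i = c}
    ⟨0, zero_mem _, by simp, by simp⟩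
    (by
      rintro _ _ ⟨y, hy, hs, rfl⟩ ⟨z, hz, ht, rfl⟩
      refine ⟨y + z, add_mem hy hz, ?_, by simp⟩
      rw [map_add]
      exact Finsupp.support_add.trans (Finset.union_subset hs ht))
    (by
      rintro _ ⟨y, hy, hs, rfl⟩
      exact ⟨-y, neg_mem hy, by rwa [map_neg, Finsupp.support_neg], by simp⟩)
    (by
      rintro c _ ⟨y, hy, hs, rfl⟩
      refine ⟨(1 ⊗ₜ c) * y, I.mul_mem_left _ _ hy, fun j hj => hs ?_,
        equivFinsuppOfBasisLeft_mul_left b c y i⟩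
      rw [Finsupp.mem_support_iff] at hj ⊢
      intro h0
      apply hj
      rw [equivFinsuppOfBasisLeft_mul_left b c y j]
      exact h0 ▸ mul_zero c)
    (by
      rintro _ c ⟨y, hy, hs, rfl⟩
      refine ⟨y * (1 ⊗ₜ c), I.mul_mem_right _ _ hy, fun j hj => hs ?_,
        equivFinsuppOfBasisLeft_mul_right b c y i⟩
      rw [Finsupp.mem_support_iff] at hj ⊢
      intro h0
      apply hj
      rw [equivFinsuppOfBasisLeft_mul_right b c y j]
      exact h0 ▸ zero_mul c)
  have hJ : J = ⊤ := by
    refine (eq_bot_or_eq_top J).resolve_left fun hJ => hi ?_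
    have : e x i ∈ J := (TwoSidedIdeal.mem_mk' ..).2 ⟨x, hxI, subset_rfl, rfl⟩
    rw [hJ] at this
    exact (TwoSidedIdeal.mem_bot _).1 this
  have h1 : (1 : B) ∈ J := hJ ▸ trivial
  obtain ⟨y, hyI, hys, hy1⟩ := (TwoSidedIdeal.mem_mk' ..).1 h1
  -- The commutator lies in `I` and loses the coordinate `i`, so minimality makes it zero. All
  -- coordinates of `y` are then central, and `y = l ⊗ 1` with `l` invertible.
  have hcomm : ∀ c : B, (1 ⊗ₜ c) * y - y * (1 ⊗ₜ c) = 0 := by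
    intro c
    apply hmin _ (sub_mem (I.mul_mem_left _ _ hyI) (I.mul_mem_right _ _ hyI))
    rw [← hxm]
    have hval : ∀ j, e ((1 ⊗ₜ c) * y - y * (1 ⊗ₜ c)) j = c * e y j - e y j * c := fun j => by
      rw [map_sub, Finsupp.sub_apply]
      exact congrArg₂ _ (equivFinsuppOfBasisLeft_mul_left b c y j)
        (equivFinsuppOfBasisLeft_mul_right b c y j)
    refine Finset.card_lt_card ((Finset.ssubset_iff_of_subset fun j hj => hys ?_).2
      ⟨i, Finsupp.mem_support_iff.2 hi, ?_⟩)
    · rw [Finsupp.mem_support_iff, hval] at hj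
      rw [Finsupp.mem_support_iff]
      intro h0
      rw [h0, mul_zero, zero_mul, sub_zero] at hj
      exact hj rfl
    · rw [Finsupp.mem_support_iff, hval, hy1, mul_one, one_mul, sub_self]
      exact fun h => h rfl
  have hcent : ∀ j, ∃ r : K, algebraMap K B r = e y j := by
    intro j
    refine Algebra.mem_bot.1 (Algebra.IsCentral.out (Subalgebra.mem_center_iff.2 fun c => ?_))
    have := congrArg (fun z => e z j) (sub_eq_zero.1 (hcomm c))
    exact (equivFinsuppOfBasisLeft_mul_left b c y j).symm.trans
      (this.trans (equivFinsuppOfBasisLeft_mul_right b c y j))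
  choose r hr using hcent
  obtain ⟨l, hl⟩ : ∃ l : L, y = l ⊗ₜ 1 := by
    refine ⟨(e y).sum fun j _ => r j • b j, ?_⟩
    refine (e.symm_apply_apply y).symm.trans ?_
    rw [TensorProduct.equivFinsuppOfBasisLeft_symm_apply, Finsupp.sum, Finsupp.sum,
      TensorProduct.sum_tmul]
    refine Finset.sum_congr rfl fun j _ => ?_
    rw [← hr, Algebra.algebraMap_eq_smul_one, TensorProduct.tmul_smul, TensorProduct.smul_tmul']
  have hl0 : l ≠ 0 := by
    rintro rfl
    rw [hl, TensorProduct.zero_tmul, map_zero] at hy1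
    exact zero_ne_one hy1
  have h2 : (1 : L ⊗[K] B) ∈ I := by
    have := I.mul_mem_left (l⁻¹ ⊗ₜ 1) _ hyI
    rwa [hl, Algebra.TensorProduct.tmul_mul_tmul, inv_mul_cancel₀ hl0, mul_one] at this
  exact (TwoSidedIdeal.one_mem_iff I).1 h2

variable {K L B}

/-- A finite dimensional central simple algebra which maps to an algebra over an extension field
has at most the dimension of the latter. -/
lemma finrank_le_of_algHom [Algebra.IsCentral K B] [IsSimpleRing B] {C : Type*} [Ring C]
    [Nontrivial C] [Algebra K C] [Algebra L C] [IsScalarTower K L C] [FiniteDimensional L C]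
    (f : B →ₐ[K] C) : finrank K B ≤ finrank L C := by
  let g : L ⊗[K] B →ₐ[L] C := Algebra.TensorProduct.lift (Algebra.ofId L C) f
    fun l b => Algebra.commutes l (f b)
  rw [← finrank_baseChange (R := L) (S := K) (M' := B)]
  -- Injectivity holds because the source is simple and the target nontrivial.
  exact LinearMap.finrank_le_finrank_of_injective (f := g.toLinearMap) (RingHom.injective g.toRingHom)

end CentralSimple

end ArithSpin

end

noncomputable section

namespace ArithSpin

open Module TensorProduct

/-! ### Hyperbolic planes and traces. -/

section Hyperbolic

variable {F V : Type*} [Field F] [AddCommGroup V] [Module F V]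

/-- The vectors `v`, `w` form a hyperbolic basis for the bilinear form `b`. -/
structure IsHyperbolicBasis (b : LinearMap.BilinForm F V) (v w : V) : Prop where
  symm : b.IsSymm
  left : b v v = 0
  right : b w w = 0
  pairing : b v w = 1
  expand : ∀ u, u = b w u • v + b v u • w

namespace IsHyperbolicBasis

variable {b : LinearMap.BilinForm F V} {v w : V}

lemma pairing' (h : IsHyperbolicBasis b v w) : b w v = 1 := by rw [h.symm.eq, h.pairing]

lemma swap (h : IsHyperbolicBasis b v w) : IsHyperbolicBasis b w v :=
  ⟨h.symm, h.right, h.left, h.pairing', fun u => (h.expand u).trans (add_comm _ _)⟩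

lemma trace_eq [FiniteDimensional F V] (h : IsHyperbolicBasis b v w) (x : End F V) :
    LinearMap.trace F V x = b w (x v) + b v (x w) := by
  have hx : x = (b w).smulRight (x v) + (b v).smulRight (x w) := by
    ext u
    conv_lhs => rw [h.expand u]
    simp
  conv_lhs => rw [hx]
  rw [map_add, LinearMap.trace_smulRight, LinearMap.trace_smulRight]

lemma trace_mulLeft [FiniteDimensional F V] (h : IsHyperbolicBasis b v w) (x : End F V) :
    LinearMap.trace F (End F V) (LinearMap.mulLeft F x) = 2 * LinearMap.trace F V x := by
  -- Left multiplication is written as a sum of four rank-one operators, so that its trace can be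
  -- read off.
  have hx : LinearMap.mulLeft F x =
      (b w ∘ₗ LinearMap.applyₗ v).smulRight ((b w).smulRight (x v)) +
      (b v ∘ₗ LinearMap.applyₗ v).smulRight ((b w).smulRight (x w)) +
      ((b w ∘ₗ LinearMap.applyₗ w).smulRight ((b v).smulRight (x v)) +
      (b v ∘ₗ LinearMap.applyₗ w).smulRight ((b v).smulRight (x w))) := by
    ext T u
    have h1 := congrArg x (h.expand (T v))
    have h2 := congrArg x (h.expand (T w))
    have h3 := congrArg (fun z => x (T z)) (h.expand u)
    simp only [map_add, map_smul] at h1 h2 h3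
    simp only [LinearMap.mulLeft_apply, Module.End.mul_apply, LinearMap.add_apply,
      LinearMap.smulRight_apply, LinearMap.comp_apply, LinearMap.applyₗ_apply_apply,
      LinearMap.smul_apply]
    rw [h3, h1, h2]
    simp only [smul_add, smul_smul, mul_comm]
  rw [hx, h.trace_eq]
  simp only [map_add, LinearMap.trace_smulRight]
  simp [h.pairing, h.pairing']
  ring

lemma mul_apply (h : IsHyperbolicBasis b v w) (x y : End F V) :
    b w ((x * y) v) = b w (x v) * b w (y v) + b w (x w) * b v (y v) := by
  rw [Module.End.mul_apply]
  conv_lhs => rw [h.expand (y v)]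
  simp
  ring

end IsHyperbolicBasis

/-- A nondegenerate symmetric bilinear form on a plane over an algebraically closed field has a
hyperbolic basis. -/
lemma exists_isHyperbolicBasis [IsAlgClosed F] [CharZero F] [FiniteDimensional F V]
    (hV : finrank F V = 2) {b : LinearMap.BilinForm F V} (hs : b.IsSymm) (hn : b.Nondegenerate) :
    ∃ v w, IsHyperbolicBasis b v w := by
  have : Invertible (2 : F) := invertibleOfNonzero two_ne_zero
  obtain ⟨u', hu'⟩ := LinearMap.BilinForm.exists_orthogonal_basis (B := b) ⟨fun x y => hs.eq x y⟩
  let u := u'.reindex (finCongr hV)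
  have hu : LinearMap.IsOrthoᵢ b u := by
    rw [LinearMap.isOrthoᵢ_def] at hu' ⊢
    intro i j hij
    rw [Basis.reindex_apply, Basis.reindex_apply]
    exact hu' _ _ fun h => hij ((finCongr hV).symm.injective h)
  have hd := hu.not_isOrtho_basis_self_of_separatingLeft hn.1
  have h01 : b (u 0) (u 1) = 0 := LinearMap.isOrthoᵢ_def.1 hu 0 1 (by decide)
  have h10 : b (u 1) (u 0) = 0 := LinearMap.isOrthoᵢ_def.1 hu 1 0 (by decide)
  have hd0 : b (u 0) (u 0) ≠ 0 := hd 0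
  have hd1 : b (u 1) (u 1) ≠ 0 := hd 1
  -- This `s` makes `u 0 ± s • u 1` isotropic. Their pairing is then `2 * b (u 0) (u 0)`, whence the
  -- scaling of the second vector.
  obtain ⟨s, hs2⟩ := IsAlgClosed.exists_pow_nat_eq (-(b (u 0) (u 0)) / b (u 1) (u 1)) two_pos
  have hs' : s ^ 2 * b (u 1) (u 1) = -b (u 0) (u 0) := by rw [hs2]; field_simp
  refine ⟨u 0 + s • u 1, (2 * b (u 0) (u 0))⁻¹ • (u 0 - s • u 1), hs, ?_, ?_, ?_, fun x => ?_⟩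
  · simp [h01, h10]
    linear_combination hs'
  · simp [h01, h10]
    right
    linear_combination hs'
  · simp [h01, h10]
    field_simp
    linear_combination -hs'
  · have hx := u.sum_repr x
    rw [Fin.sum_univ_two] at hx
    rw [← hx]
    generalize u.repr x 0 = p
    generalize u.repr x 1 = q
    have h1 : b ((2 * b (u 0) (u 0))⁻¹ • (u 0 - s • u 1)) (p • u 0 + q • u 1) =
        (2 * b (u 0) (u 0))⁻¹ * (p * b (u 0) (u 0) - s * q * b (u 1) (u 1)) := by
      simp only [map_smul, map_sub, map_add, LinearMap.smul_apply, LinearMap.sub_apply, h01, h10,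
        smul_eq_mul]
      ring
    have h2 : b (u 0 + s • u 1) (p • u 0 + q • u 1) =
        p * b (u 0) (u 0) + s * q * b (u 1) (u 1) := by
      simp [h01, h10]
      ring
    rw [h1, h2]
    have h3 : p = (2 * b (u 0) (u 0))⁻¹ * (p * b (u 0) (u 0) - s * q * b (u 1) (u 1)) +
        (2 * b (u 0) (u 0))⁻¹ * (p * b (u 0) (u 0) + s * q * b (u 1) (u 1)) := by
      field_simp
      ring
    have h4 : q = s * ((2 * b (u 0) (u 0))⁻¹ * (p * b (u 0) (u 0) - s * q * b (u 1) (u 1)) -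
        (2 * b (u 0) (u 0))⁻¹ * (p * b (u 0) (u 0) + s * q * b (u 1) (u 1))) := by
      field_simp
      linear_combination (2 * q) * hs'
    conv_lhs => rw [h3, h4]
    module

end Hyperbolic

/-! ### Characters of the even Clifford algebra of a quaternion algebra. -/

section Clifford

variable {A : Type*} [Ring A] [Algebra ℚ A] {σ : A →ₗ[ℚ] A} {V : Type} [AddCommGroup V]
  [Module ℂ V] {b : LinearMap.BilinForm ℂ V} {v w : V}

lemma sandwich_baseChange_tmul (a c : A) (x : ℂ ⊗[ℚ] A) :
    (sandwich (a ⊗ₜ c)).baseChange ℂ x = (1 ⊗ₜ a) * x * (1 ⊗ₜ c) := by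
  induction x using TensorProduct.induction_on with
  | zero => simp
  | tmul l d => simp [sandwich]
  | add x y hx hy => rw [map_add, hx, hy, mul_add, add_mul]

/-- In degree 2, left multiplication has twice the matrix trace, and the division by the degree
cancels this factor. -/
lemma IsHyperbolicBasis.reducedTrace_eq [FiniteDimensional ℂ V]
    (h : IsHyperbolicBasis b v w) [FiniteDimensional ℚ A] (hA : finrank ℚ A = 4)
    (e : (ℂ ⊗[ℚ] A) ≃ₐ[ℂ] End ℂ V) (a : A) :
    ((reducedTrace a : ℚ) : ℂ) = b w (e (1 ⊗ₜ a) v) + b v (e (1 ⊗ₜ a) w) := by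
  have hdeg : csaDegree A = 2 := by
    rw [csaDegree, hA, show (4 : ℕ) = 2 * 2 from rfl, Nat.sqrt_eq]
  have h1 := LinearMap.trace_baseChange (LinearMap.mulLeft ℚ a) ℂ
  have h2 : e.toLinearEquiv.conj ((LinearMap.mulLeft ℚ a).baseChange ℂ) =
      LinearMap.mulLeft ℂ (e (1 ⊗ₜ a)) := by
    have h3 : (LinearMap.mulLeft ℚ a).baseChange ℂ = LinearMap.mulLeft ℂ ((1 : ℂ) ⊗ₜ[ℚ] a) := by
      ext x
      simp
    ext1 x
    rw [h3]
    simp [LinearEquiv.conj_apply]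
  rw [← LinearMap.trace_conj' _ e.toLinearEquiv, h2, h.trace_mulLeft, h.trace_eq] at h1
  rw [reducedTrace, hdeg]
  push_cast
  rw [← eq_ratCast (algebraMap ℚ ℂ), ← h1]
  ring

/-- There is a skew element which acts as `1` on `v` and as `-1` on `w`. -/
lemma IsHyperbolicBasis.exists_reflection (h : IsHyperbolicBasis b v w)
    (hb : b.Nondegenerate) (e : (ℂ ⊗[ℚ] A) ≃ₐ[ℂ] End ℂ V)
    (he : ∀ (x : ℂ ⊗[ℚ] A) (v w : V), b v (e x w) = b (e (σ.baseChange ℂ x) v) w) :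
    ∃ x : ℂ ⊗[ℚ] A, σ.baseChange ℂ x = -x ∧ e x v = v ∧ e x w = -w := by
  -- `D` is `diag(1, -1)`, which is skew for the hyperbolic form.
  let D : End ℂ V := (b w).smulRight v - (b v).smulRight w
  have hD : ∀ y z, b y (D z) = -b (D y) z := by
    intro y z
    simp [D, h.symm.eq y v, h.symm.eq y w]
    ring
  refine ⟨e.symm D, ?_, ?_, ?_⟩
  · apply e.injective
    rw [map_neg, e.apply_symm_apply]
    ext1 y
    rw [← sub_eq_zero]
    apply hb.1
    intro z
    rw [map_sub, LinearMap.sub_apply, ← he, e.apply_symm_apply, hD, LinearMap.neg_apply, map_neg,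
      LinearMap.neg_apply, sub_self]
  · rw [e.apply_symm_apply]
    simp [D, h.pairing', h.left]
  · rw [e.apply_symm_apply]
    simp [D, h.pairing, h.right]

/-- This is the second Clifford relation for the diagonal entry `f`. Since the sandwich map of `u`
is `σ`-invariant, it kills the skew element `x = diag(1, -1)`; the diagonal entry of this vanishing
is the claim. -/
lemma IsHyperbolicBasis.coefficient_tensor (h : IsHyperbolicBasis b v w)
    (hb : b.Nondegenerate) (e : (ℂ ⊗[ℚ] A) ≃ₐ[ℂ] End ℂ V)
    (he : ∀ (x : ℂ ⊗[ℚ] A) (v w : V), b v (e x w) = b (e (σ.baseChange ℂ x) v) w)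
    (f : A →ₗ[ℚ] ℂ) (hf : ∀ a, f a = b w (e (1 ⊗ₜ a) v))
    (u : A ⊗[ℚ] A) (hu : ∀ x, sandwich u (σ x) = sandwich u x) :
    LinearMap.mul' ℚ ℂ (TensorProduct.map f f u) = 1 / 2 * f (LinearMap.mul' ℚ A u) := by
  obtain ⟨x, hx, hv, hw⟩ := h.exists_reflection hb e he
  have h1 : (sandwich u).baseChange ℂ x = 0 := by
    have h2 : (sandwich u ∘ₗ σ).baseChange ℂ x = (sandwich u).baseChange ℂ x := by
      congr 2
      exact LinearMap.ext hu
    rw [LinearMap.baseChange_comp, LinearMap.comp_apply, hx, map_neg] at h2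
    have h3 : (2 : ℂ) • (sandwich u).baseChange ℂ x = 0 := by
      rw [two_smul]
      nth_rewrite 1 [← h2]
      exact neg_add_cancel _
    exact (smul_eq_zero.1 h3).resolve_left two_ne_zero
  -- For `u = a ⊗ c` the entry of `a x c` is `a₁₁c₁₁ - a₁₂c₂₁ = 2a₁₁c₁₁ - (ac)₁₁`.
  have h3 : ∀ u : A ⊗[ℚ] A, b w (e ((sandwich u).baseChange ℂ x) v) =
      2 * LinearMap.mul' ℚ ℂ (TensorProduct.map f f u) - f (LinearMap.mul' ℚ A u) := by
    intro u
    induction u using TensorProduct.induction_on with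
    | zero => simp
    | tmul a c =>
      have h5 : (1 : ℂ) ⊗ₜ[ℚ] (a * c) = (1 ⊗ₜ a) * (1 ⊗ₜ c) := by simp
      rw [sandwich_baseChange_tmul, map_mul, h.mul_apply, map_mul, h.mul_apply]
      simp only [TensorProduct.map_tmul, LinearMap.mul'_apply]
      rw [hf, hf, hf, h5, map_mul, h.mul_apply]
      simp only [Module.End.mul_apply, hv, hw, map_neg]
      rw [h.left, h.pairing']
      ring
    | add y z hy hz =>
      simp only [map_add, LinearMap.baseChange_add, LinearMap.add_apply, hy, hz]
      ring
  have h6 := h3 u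
  rw [h1, map_zero, LinearMap.zero_apply, map_zero] at h6
  linear_combination (-1 / 2) * h6

/-- A diagonal coefficient of `A` in a hyperbolic basis extends to the even Clifford algebra. -/
lemma IsHyperbolicBasis.exists_algHom [FiniteDimensional ℂ V] (h : IsHyperbolicBasis b v w)
    (hb : b.Nondegenerate) [FiniteDimensional ℚ A] (hA : finrank ℚ A = 4)
    (e : (ℂ ⊗[ℚ] A) ≃ₐ[ℂ] End ℂ V)
    (he : ∀ (x : ℂ ⊗[ℚ] A) (v w : V), b v (e x w) = b (e (σ.baseChange ℂ x) v) w) :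
    ∃ φ : EvenClifford σ →ₐ[ℚ] ℂ, ∀ a, φ (toEvenClifford σ a) = b w (e (1 ⊗ₜ a) v) := by
  let f : A →ₗ[ℚ] ℂ := ((b w ∘ₗ LinearMap.applyₗ v ∘ₗ e.toLinearMap).restrictScalars ℚ) ∘ₗ
    TensorProduct.mk ℚ ℂ A 1
  have hf : ∀ a, f a = b w (e (1 ⊗ₜ a) v) := fun a => rfl
  have hrel : ∀ ⦃x y⦄, CliffordRel σ x y → TensorAlgebra.lift ℚ f x = TensorAlgebra.lift ℚ f y := by
    intro x y hxy
    induction hxy with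
    | symm s hs =>
      have h1 := h.reducedTrace_eq hA e s
      -- A symmetric element has equal diagonal entries, so each is half the trace, as the first
      -- Clifford relation demands.
      have h2 : b w (e (1 ⊗ₜ s) v) = b v (e (1 ⊗ₜ s) w) := by
        rw [he, LinearMap.baseChange_tmul, hs, h.symm.eq]
      rw [TensorAlgebra.lift_ι_apply, AlgHom.commutes, hf, eq_ratCast]
      push_cast
      rw [h1, ← h2]
      ring
    | tensor u hu =>
      have h1 : TensorAlgebra.lift ℚ f (tensorTwo A u) =
          LinearMap.mul' ℚ ℂ (TensorProduct.map f f u) := by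
        clear hu
        induction u using TensorProduct.induction_on with
        | zero => simp
        | tmul a c => simp [tensorTwo]
        | add y z hy hz => rw [map_add, map_add, hy, hz, map_add, map_add]
      rw [h1, h.coefficient_tensor hb e he f hf u hu, TensorAlgebra.lift_ι_apply, map_smul,
        Algebra.smul_def]
      simp
  refine ⟨RingQuot.liftAlgHom ℚ ⟨TensorAlgebra.lift ℚ f, hrel⟩, fun a => ?_⟩
  rw [toEvenClifford, LinearMap.comp_apply, AlgHom.toLinearMap_apply,
    RingQuot.liftAlgHom_mkAlgHom_apply, TensorAlgebra.lift_ι_apply, hf]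

end Clifford

section Quaternion

variable {A : Type*} [Ring A] [Algebra ℚ A] {σ : A →ₗ[ℚ] A}

/-- A finite dimensional central simple algebra is a form of a matrix algebra. -/
lemma exists_splitting [Algebra.IsCentral ℚ A] [IsSimpleRing A] [FiniteDimensional ℚ A] :
    ∃ n : ℕ, n ≠ 0 ∧ finrank ℚ A = n ^ 2 ∧
      Nonempty ((ℂ ⊗[ℚ] A) ≃ₐ[ℂ] End ℂ (Fin n → ℂ)) := by
  obtain ⟨n, hn, ⟨e⟩⟩ := IsSimpleRing.exists_algEquiv_matrix_of_isAlgClosed ℂ (ℂ ⊗[ℚ] A)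
  refine ⟨n, hn.out, ?_, ⟨e.trans Matrix.toLinAlgEquiv'⟩⟩
  have h := e.toLinearEquiv.finrank_eq
  rw [finrank_baseChange, finrank_matrix] at h
  simpa [sq] using h

/-- The even Clifford algebra of a quaternion algebra with orthogonal involution is not reduced to
the scalars. -/
lemma evenClifford_bot_ne_top (hσ : IsTwistedQuadraticSpace σ) (hA : finrank ℚ A = 4) :
    Nontrivial (EvenClifford σ) ∧ (⊥ : Subalgebra ℚ (EvenClifford σ)) ≠ ⊤ := by
  have := hσ.isCentral
  have := hσ.isSimple
  have := hσ.finite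
  obtain ⟨n, -, hn, ⟨e⟩⟩ := exists_splitting (A := A)
  have hn2 : n = 2 := by
    rw [hA] at hn
    nlinarith [sq_nonneg ((n : ℤ) - 2)]
  subst hn2
  obtain ⟨b, hs, hb, he⟩ := hσ.orthogonal ℂ (Fin 2 → ℂ) e
  obtain ⟨v, w, h⟩ := exists_isHyperbolicBasis (by simp) hs hb
  obtain ⟨φ, hφ⟩ := h.exists_algHom hb hA e he
  -- Exchanging the isotropic vectors gives the other diagonal entry.
  obtain ⟨ψ, hψ⟩ := h.swap.exists_algHom hb hA e he
  refine ⟨RingHom.domain_nontrivial φ.toRingHom, fun htop => ?_⟩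
  -- On `ℚ` the two characters would agree, so every matrix would have equal diagonal entries;
  -- `diag(1, -1)` contradicts this.
  have h1 : ∀ x : ℂ ⊗[ℚ] A, b w (e x v) = b v (e x w) := by
    intro x
    induction x using TensorProduct.induction_on with
    | zero => simp
    | tmul l a =>
      have h2 : toEvenClifford σ a ∈ (⊥ : Subalgebra ℚ (EvenClifford σ)) := htop ▸ trivial
      obtain ⟨r, hr⟩ := Algebra.mem_bot.1 h2
      have h3 : b w (e (1 ⊗ₜ a) v) = b v (e (1 ⊗ₜ a) w) := by
        rw [← hφ, ← hψ, ← hr, AlgHom.commutes, AlgHom.commutes]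
      have h4 : l ⊗ₜ[ℚ] a = l • ((1 : ℂ) ⊗ₜ[ℚ] a) := by simp [TensorProduct.smul_tmul']
      rw [h4, map_smul, LinearMap.smul_apply, LinearMap.smul_apply, map_smul, map_smul, h3]
    | add y z hy hz => simp [hy, hz]
  obtain ⟨x, -, hv, hw⟩ := h.exists_reflection hb e he
  have h5 := h1 x
  rw [hv, hw, map_neg, h.pairing, h.pairing'] at h5
  norm_num at h5

end Quaternion

end ArithSpin

end



noncomputable section

namespace ArithSpin

open Module TensorProduct Polynomial

universe u

/-! ### Reversed characteristic polynomials and the one-dimensional case. -/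

section Determinants

variable {F V : Type*} [Field F] [AddCommGroup V] [Module F V]

lemma revCharpoly_smul_one [FiniteDimensional F V] (r : F) :
    revCharpoly (r • (1 : End F V)) = (1 - C r * X) ^ finrank F V := by
  have h : (1 : End F[X] (F[X] ⊗[F] V)) - (X : F[X]) • (r • (1 : End F V)).baseChange F[X] =
      (1 - C r * X) • (1 : End F[X] (F[X] ⊗[F] V)) := by
    have h1 : (1 : End F V).baseChange F[X] = 1 := LinearMap.baseChange_id
    have h2 : r • (1 : End F[X] (F[X] ⊗[F] V)) = C r • (1 : End F[X] (F[X] ⊗[F] V)) := by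
      rw [← algebraMap_smul F[X] r]; rfl
    rw [LinearMap.baseChange_smul, h1, h2, smul_smul, mul_comm]
    module
  rw [revCharpoly, h, LinearMap.det_smul, finrank_baseChange]
  simp

/-- The reversed characteristic polynomial of an endomorphism with square `r` which is given by a
companion matrix. -/
lemma revCharpoly_of_basis {f : End F V} {r : F} (b : Basis (Fin 2) F V) (h0 : f (b 0) = b 1)
    (h1 : f (b 1) = r • b 0) : revCharpoly f = 1 - C r * X ^ 2 := by
  rw [revCharpoly, ← LinearMap.det_toMatrix (b.baseChange F[X]), Matrix.det_fin_two]
  simp only [LinearMap.toMatrix_apply, Basis.baseChange_apply, LinearMap.sub_apply, End.one_apply,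
    LinearMap.smul_apply, LinearMap.baseChange_tmul, h0, h1, map_sub, map_smul, Finsupp.sub_apply,
    Finsupp.smul_apply, Basis.baseChange_repr_tmul, Basis.repr_self]
  simp [Algebra.smul_def]
  ring

end Determinants

/-- This is how spinorial type excludes `B = ℚ`. -/
lemma IsInvolutionFirstKind.eq_id_of_finrank_eq_one {A : Type*} [Ring A] [Algebra ℚ A]
    {σ : A →ₗ[ℚ] A} (hσ : IsInvolutionFirstKind σ) (hA : finrank ℚ A = 1) : σ = LinearMap.id := by
  have : Nontrivial A := nontrivial_of_finrank_pos (R := ℚ) (by omega)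
  ext x
  have hx : x ∈ (⊥ : Subalgebra ℚ A) := by
    rw [Subalgebra.bot_eq_top_of_finrank_eq_one hA]
    trivial
  obtain ⟨r, rfl⟩ := Algebra.mem_bot.1 hx
  exact hσ.map_algebraMap r

/-! ### Dimensions of the endomorphism algebra and of the rational Tate module. -/

section Tate

variable {k : Type u} [Field k] (W : WeierstrassCurve k) (ℓ : ℕ) [Fact ℓ.Prime]

lemma tateMap_mul (φ ψ : AddMonoid.End (GeomPoint W)) :
    tateMap ℓ (φ * ψ) = tateMap ℓ φ ∘ₗ tateMap ℓ ψ := rfl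

lemma tateMap_add (φ ψ : AddMonoid.End (GeomPoint W)) :
    tateMap ℓ (φ + ψ) = tateMap ℓ φ + tateMap ℓ ψ := rfl

variable [W.IsElliptic]

/-- The action of endomorphisms on the rational Tate module. -/
def rationalTateRep : endRing W →+* End ℚ_[ℓ] (rationalTate W ℓ) where
  toFun φ := (tateMap ℓ φ.1).baseChange ℚ_[ℓ]
  map_one' := LinearMap.baseChange_id
  map_mul' φ ψ := by
    rw [Subring.coe_mul, tateMap_mul, LinearMap.baseChange_comp]
    rfl
  map_zero' := LinearMap.baseChange_zero
  map_add' φ ψ := by rw [Subring.coe_add, tateMap_add, LinearMap.baseChange_add]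

variable {W ℓ}

/-- The torsion count suffices: `ℓ ^ d ≤ 2ℓ² - 1 < ℓ³` for every prime `ℓ`. -/
lemma finite_rationalTate : FiniteDimensional ℚ_[ℓ] (rationalTate W ℓ) ∧
    finrank ℚ_[ℓ] (rationalTate W ℓ) ≤ 2 := by
  have hE : (W.map (algebraMap k (AlgebraicClosure k))).IsElliptic := inferInstance
  have hp : ℓ.Prime := Fact.out
  obtain ⟨hfin, hcard⟩ := WeierstrassCurve.Affine.Point.finite_torsion
    (W := W.map (algebraMap k (AlgebraicClosure k))) hp.ne_zero
  have h1 := finite_tateModule (M := GeomPoint W) (ℓ := ℓ) hfin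
  have h2 := pow_finrank_tateModule_le (M := GeomPoint W) (ℓ := ℓ) hfin
  refine ⟨inferInstance, ?_⟩
  rw [finrank_baseChange]
  by_contra! h3
  have h4 : ℓ ^ 3 ≤ 2 * ℓ ^ 2 - 1 :=
    (Nat.pow_le_pow_right hp.pos h3).trans (h2.trans hcard)
  have h5 : 2 * ℓ ^ 2 ≤ ℓ ^ 3 := by
    rw [pow_succ ℓ 2, mul_comm]
    exact Nat.mul_le_mul_left _ hp.two_le
  have h6 : 0 < ℓ ^ 2 := pow_pos hp.pos 2
  omega

/-- Here `ℓ` must differ from the characteristic: for a supersingular curve the Tate module at the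
characteristic is zero. -/
lemma nontrivial_rationalTate (hℓ : (ℓ : k) ≠ 0) : finrank ℚ_[ℓ] (rationalTate W ℓ) ≠ 0 := by
  have hE : (W.map (algebraMap k (AlgebraicClosure k))).IsElliptic := inferInstance
  have hp : ℓ.Prime := Fact.out
  have hF : (ℓ : AlgebraicClosure k) ≠ 0 := by
    rw [← map_natCast (algebraMap k (AlgebraicClosure k))]
    exact (_root_.map_ne_zero _).2 hℓ
  have h1 := nontrivial_tateModule (M := GeomPoint W) (ℓ := ℓ)
    (WeierstrassCurve.Affine.Point.nsmul_surjective
      (W := W.map (algebraMap k (AlgebraicClosure k))) hp.ne_zero)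
    (WeierstrassCurve.Affine.Point.exists_ne_zero_nsmul_eq_zero
      (W := W.map (algebraMap k (AlgebraicClosure k))) hp.one_lt hF)
  have h2 := finite_tateModule (M := GeomPoint W) (ℓ := ℓ)
    (WeierstrassCurve.Affine.Point.finite_torsion
      (W := W.map (algebraMap k (AlgebraicClosure k))) hp.ne_zero).1
  rw [finrank_baseChange]
  exact (finrank_pos (R := ℤ_[ℓ]) (M := tateModule (GeomPoint W) ℓ)).ne'

variable (W ℓ) in
/-- The action of the endomorphism algebra on the rational Tate module, in matrix form. -/
def endAlgRep [FiniteDimensional ℚ_[ℓ] (rationalTate W ℓ)] :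
    EndAlg W →ₐ[ℚ] Matrix (Fin (finrank ℚ_[ℓ] (rationalTate W ℓ)))
      (Fin (finrank ℚ_[ℓ] (rationalTate W ℓ))) ℚ_[ℓ] :=
  Algebra.TensorProduct.lift (Algebra.ofId ℚ _)
    ((algEquivMatrix (finBasis ℚ_[ℓ] (rationalTate W ℓ))).toRingEquiv.toRingHom.comp
      (rationalTateRep W ℓ)).toIntAlgHom
    fun r _ => Algebra.commutes r _

lemma endAlgRep_one_tmul [FiniteDimensional ℚ_[ℓ] (rationalTate W ℓ)] (φ : endRing W) :
    endAlgRep W ℓ (1 ⊗ₜ φ) =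
      algEquivMatrix (finBasis ℚ_[ℓ] (rationalTate W ℓ)) (rationalTateRep W ℓ φ) := by
  simp [endAlgRep]

/-- For a curve with a spin structure, the endomorphism algebra has dimension four, and the
rational Tate module has dimension two. -/
lemma IsSpinStructure.finrank_eq {σ : EndAlg W →ₗ[ℚ] EndAlg W} (hσ : IsSpinStructure W σ)
    (hℓ : (ℓ : k) ≠ 0) :
    finrank ℚ (EndAlg W) = 4 ∧ finrank ℚ_[ℓ] (rationalTate W ℓ) = 2 := by
  have := hσ.twisted.isCentral
  have := hσ.twisted.isSimple
  have := hσ.twisted.finite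
  obtain ⟨h1, h2⟩ := finite_rationalTate (W := W) (ℓ := ℓ)
  have h3 := nontrivial_rationalTate (W := W) hℓ
  have : NeZero (finrank ℚ_[ℓ] (rationalTate W ℓ)) := ⟨h3⟩
  -- This yields `n² ≤ d²`. With `n ≥ 2` from the nontrivial involution and `d ≤ 2` from the torsion
  -- count, both are 2.
  have h4 := finrank_le_of_algHom (L := ℚ_[ℓ]) (endAlgRep W ℓ)
  rw [finrank_matrix, finrank_self, mul_one, Fintype.card_fin] at h4
  obtain ⟨n, hn0, hn, -⟩ := exists_splitting (A := EndAlg W)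
  have hn1 : n ≠ 1 := by
    rintro rfl
    obtain ⟨σ', hσ', hne⟩ := hσ.spinorial
    exact hne (hσ'.eq_id_of_finrank_eq_one hn)
  rw [hn] at h4 ⊢
  generalize finrank ℚ_[ℓ] (rationalTate W ℓ) = d at *
  have hn2 : 2 ≤ n := by omega
  constructor
  · nlinarith
  · nlinarith

variable [Fintype k]

/-- If Frobenius is the scalar `r`, then it acts on cohomology as `r`. -/
lemma frobH1_eq [FiniteDimensional ℚ_[ℓ] (rationalTate W ℓ)] {r : ℚ}
    (hr : algebraMap ℚ (EndAlg W) r = frobAlg W) :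
    frobH1 W ℓ = (r : ℚ_[ℓ]) • (1 : End ℚ_[ℓ] (ellAdicH1 W ℓ)) := by
  -- Frobenius equals `r` only after tensoring with `ℚ`, so the identity is carried to the Tate
  -- module by the representation of `B`.
  have h1 : algEquivMatrix (finBasis ℚ_[ℓ] (rationalTate W ℓ)) (rationalTateRep W ℓ (frobEnd W)) =
      algEquivMatrix (finBasis ℚ_[ℓ] (rationalTate W ℓ))
        (algebraMap ℚ_[ℓ] (End ℚ_[ℓ] (rationalTate W ℓ)) r) := by
    rw [← endAlgRep_one_tmul, AlgEquiv.commutes, ← frobAlg, ← hr, AlgHom.commutes,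
      IsScalarTower.algebraMap_apply ℚ ℚ_[ℓ], eq_ratCast]
  have h2 : (tateMap ℓ (frobPoint W)).baseChange ℚ_[ℓ] = (r : ℚ_[ℓ]) • LinearMap.id :=
    AlgEquiv.injective _ h1
  ext f x
  rw [frobH1, h2]
  simp

end Tate

/-! ### Square roots of rational numbers in the even Clifford algebra. -/

section Spin

/-- A scalar is symmetric with reduced trace `2r`, and the first Clifford relation identifies it
with half of that. -/
lemma toEvenClifford_algebraMap {A : Type*} [Ring A] [Algebra ℚ A] {σ : A →ₗ[ℚ] A}
    (hσ : IsInvolutionFirstKind σ) (hA : finrank ℚ A = 4) (r : ℚ) :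
    toEvenClifford σ (algebraMap ℚ A r) = algebraMap ℚ (EvenClifford σ) r := by
  have : FiniteDimensional ℚ A := .of_finrank_pos (by omega)
  have h1 := RingQuot.mkAlgHom_rel ℚ (CliffordRel.symm _ (hσ.map_algebraMap r))
  have h2 : reducedTrace (algebraMap ℚ A r) = 2 * r := by
    have hdeg : csaDegree A = 2 := by
      rw [csaDegree, hA, show (4 : ℕ) = 2 * 2 from rfl, Nat.sqrt_eq]
    have h3 : LinearMap.mulLeft ℚ (algebraMap ℚ A r) = r • LinearMap.id := by
      ext x
      simp [Algebra.smul_def]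
    rw [reducedTrace, h3, map_smul, LinearMap.trace_id, hA, hdeg, smul_eq_mul]
    push_cast
    ring
  rw [AlgHom.commutes, h2, mul_div_cancel_left₀ r two_ne_zero] at h1
  exact h1

/-- The reversed characteristic polynomial of a square root of a rational number which generates
an algebra different from `ℚ`. -/
lemma revCharpoly_mulLeft_of_sq {A : Type*} [Ring A] [Nontrivial A] [Algebra ℚ A]
    (hA : (⊥ : Subalgebra ℚ A) ≠ ⊤) {y : A} {r : ℚ} (hy : y ^ 2 = algebraMap ℚ A r)
    (hgen : Algebra.adjoin ℚ {y} = ⊤) :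
    revCharpoly (LinearMap.mulLeft ℚ y) = 1 - C r * X ^ 2 := by
  -- If `y` were rational it would generate only the scalars.
  have hli : LinearIndependent ℚ ![1, y] := by
    rw [LinearIndependent.pair_iff' one_ne_zero]
    intro a ha
    apply hA
    rw [eq_comm, eq_bot_iff, ← hgen, Algebra.adjoin_le_iff, Set.singleton_subset_iff]
    exact Algebra.mem_bot.2 ⟨a, by rw [Algebra.algebraMap_eq_smul_one, ha]⟩
  -- The span of `1` and `y` is closed under multiplication because `y ^ 2` is rational; no field
  -- structure is needed.
  have hspan : ⊤ ≤ Submodule.span ℚ (Set.range ![(1 : A), y]) := by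
    rintro x -
    have hx : x ∈ Algebra.adjoin ℚ {y} := hgen ▸ trivial
    simp only [Matrix.range_cons, Matrix.range_empty, Set.union_empty, Set.singleton_union,
      Submodule.mem_span_pair]
    induction hx using Algebra.adjoin_induction with
    | mem z hz => exact ⟨0, 1, by rw [Set.mem_singleton_iff.1 hz]; simp⟩
    | algebraMap c => exact ⟨c, 0, by simp [Algebra.algebraMap_eq_smul_one]⟩
    | add z z' _ _ h h' =>
      obtain ⟨a, b, rfl⟩ := h
      obtain ⟨a', b', rfl⟩ := h'
      exact ⟨a + a', b + b', by module⟩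
    | mul z z' _ _ h h' =>
      obtain ⟨a, b, rfl⟩ := h
      obtain ⟨a', b', rfl⟩ := h'
      refine ⟨a * a' + b * b' * r, a * b' + b * a', ?_⟩
      rw [sq, Algebra.algebraMap_eq_smul_one] at hy
      simp only [add_mul, mul_add, smul_mul_assoc, mul_smul_comm, one_mul, mul_one, hy]
      module
  let b := Basis.mk hli hspan
  have : FiniteDimensional ℚ A := .of_basis b
  refine revCharpoly_of_basis b ?_ ?_
  · simp [b]
  · rw [sq, Algebra.algebraMap_eq_smul_one] at hy
    simp [b, hy]

end Spin

end ArithSpin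

end

/-! ### The identity of L-functions. -/

/-- For an elliptic curve `E` over a finite field `k` with `q` elements, an arithmetic spin structure
`(B, σ)` and a spinorial lifting `ρ` of the similitude representation with `K = ℚ(√τ)`,
`√τ = ρ(Frob)`, one has `L(E, s) = L(ρ, s / 2) ^ 2`.  Both sides are reciprocals of entire functions,
and at a common pole both take the value `0` here. -/
theorem mainTheorem4 {k : Type*} [Field k] [Fintype k] (W : WeierstrassCurve k) [W.IsElliptic]
    (σ : ArithSpin.EndAlg W →ₗ[ℚ] ArithSpin.EndAlg W) (hσ : ArithSpin.IsSpinStructure W σ)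
    (ρ : ArithSpin.weilGroup k →* ArithSpin.GSpin σ) (hρ : ArithSpin.IsSpinorialLift hσ ρ)
    (hK : Algebra.adjoin ℚ
      {(ρ (ArithSpin.weilFrob k) : ArithSpin.EvenClifford σ)} = ⊤)
    (ℓ : ℕ) [Fact ℓ.Prime] (hℓ : (ℓ : k) ≠ 0) (ι : ℚ_[ℓ] →+* ℂ) :
    (∀ s : ℂ, ArithSpin.LFunctionCurve W ℓ ι s = ArithSpin.LFunctionSpin ρ (s / 2) ^ 2) ∧
      ArithSpin.LFunctionCurve W ℓ ι 1 = ArithSpin.LFunctionSpin ρ (1 / 2) ^ 2 := by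
  suffices h : ∀ s : ℂ, ArithSpin.LFunctionCurve W ℓ ι s = ArithSpin.LFunctionSpin ρ (s / 2) ^ 2 from
    ⟨h, h 1⟩
  intro s
  have hc := hσ.twisted.isCentral
  obtain ⟨hB, hV⟩ := hσ.finrank_eq hℓ
  have hfin := (ArithSpin.finite_rationalTate (W := W) (ℓ := ℓ)).1
  -- Frobenius is central and `B` has centre `ℚ`, so `τ = r`.
  obtain ⟨r, hr⟩ := Algebra.mem_bot.1 (hc.out
    (Subalgebra.mem_center_iff.2 fun b => (ArithSpin.frobAlg_commute b).symm))
  obtain ⟨hnt, hbot⟩ := ArithSpin.evenClifford_bot_ne_top hσ.twisted hB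
  have hy : (ρ (ArithSpin.weilFrob k) : ArithSpin.EvenClifford σ) ^ 2 =
      algebraMap ℚ (ArithSpin.EvenClifford σ) r := by
    rw [hρ, ArithSpin.similitudeRep_weilFrob, ← hr,
      ArithSpin.toEvenClifford_algebraMap hσ.twisted.firstKind hB]
  have hq : ((Fintype.card k : ℂ) ^ (-(s / 2))) ^ 2 = (Fintype.card k : ℂ) ^ (-s) := by
    rw [← Complex.cpow_nat_mul]
    congr 1
    push_cast
    ring
  -- Both sides become the inverse square of `1 - r q^{-s}`; the embedding `ι` fixes the rational
  -- number `r`.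
  rw [ArithSpin.LFunctionCurve, ArithSpin.LFunctionSpin, ArithSpin.frobH1_eq hr,
    ArithSpin.revCharpoly_smul_one, ArithSpin.revCharpoly_mulLeft_of_sq hbot hy hK,
    Subspace.dual_finrank_eq, hV]
  simp [hq]
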